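/- Fix a dimension $d\ge 1$. For the law of a random vector $X$ on $\mathbb{R}^d$ with density $f$, put $h(X)=-\int f\log f$, $N(X)=\frac{1}{2\pi e}e^{\frac{2}{d}h(X)}$, $J(X)=\int f|\nabla\log f|^2$ and, with $\phi(x)=(2\pi)^{-d/2}e^{-|x|^2/2}$, $D(X)=\int f\log\frac{f}{\phi}$ and $I(X)=\int f\left|\nabla\log\frac{f}{\phi}\right|^2$, where $\nabla\log f=f^{-1}\nabla f$ with $\nabla f$ the weak gradient of $f$. By convention $J(X)=I(X)=\infty$ if $X$ has no density or the density has no (locally integrable) weak gradient, and $D(X)=\infty$, $h(X)=-\infty$, $N(X)=0$ if $X$ has no density. Put $\mathsf{p}(X)=\frac1d N(X)J(X)$, with $\mathsf{p}(X)=\infty$ if $J(X)=\infty$. All quantities except $h$ take values in $[0,\infty]$; elsewhere $0\cdot\infty=0$. Consider the following statements. (A) (Interpolation inequality.) For all independent, centered random vectors $X,Y$ on $\mathbb{R}^d$ (that is, integrable with mean zero) and all $\theta\in[0,1]$, $$D(X)+D(Y)\le \frac{1-\theta}{2}I(X)+\frac{\theta}{2}I(Y)+D\big(\sqrt{\theta}\,X+\sqrt{1-\theta}\,Y\big).$$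 (B) (Reverse entropy power inequality.) For all independent random vectors $X,Y$ on $\mathbb{R}^d$ with finite second moments and with $N(X),N(Y)$ not both zero, and for $\lambda\in[0,1]$ satisfying $\frac{\lambda}{1-\lambda}=\frac{N(Y)}{N(X)}$ (ratios in $[0,\infty]$), $$N(X+Y)\le\big(N(X)+N(Y)\big)\big(\lambda\,\mathsf{p}(X)+(1-\lambda)\,\mathsf{p}(Y)\big).$$ (C) (Reverse Fisher information inequality.) For all independent random vectors $X,Y$ on $\mathbb{R}^d$ with finite second moments and $J(X),J(Y)<\infty$, $$\frac{1}{J(X+Y)}\le\Big(\frac{1}{J(X)}+\frac{1}{J(Y)}\Big)\,\mathsf{p}(X)\,\mathsf{p}(Y).$$ Proposition. For every $d\ge1$, (A) holds if and only if (B) holds, and (A) holds if and only if both (B) and (C) hold. -/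

import Mathlib

open MeasureTheory ProbabilityTheory
open scoped ENNReal

universe u

noncomputable section

/-- The density `f` of a measure on `ℝᵈ` with respect to Lebesgue measure. -/
def lebDensity {d : ℕ} (μ : Measure (EuclideanSpace ℝ (Fin d))) (x : EuclideanSpace ℝ (Fin d)) : ℝ :=
  (μ.rnDeriv volume x).toReal

/-- Differential entropy `h = -∫ f log f`, as an extended real: the integral of the positive part
of `-f log f` minus the integral of its negative part. It is `-∞` if there is no density.
For a law with finite second moment the first integral is always finite, so that the
difference is never of the form `∞ - ∞`. -/
def diffEntropy {d : ℕ} (μ : Measure (EuclideanSpace ℝ (Fin d))) : EReal :=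
  open Classical in
  if μ ≪ volume then
    ((∫⁻ x, ENNReal.ofReal (-(lebDensity μ x * Real.log (lebDensity μ x))) : ℝ≥0∞) : EReal)
      - ((∫⁻ x, ENNReal.ofReal (lebDensity μ x * Real.log (lebDensity μ x)) : ℝ≥0∞) : EReal)
  else ⊥

/-- Entropy power `N = (2πe)⁻¹ exp (2h/d)`, with values in `[0, ∞]`. -/
def entropyPower {d : ℕ} (μ : Measure (EuclideanSpace ℝ (Fin d))) : ℝ≥0∞ :=
  ENNReal.ofReal (1 / (2 * Real.pi * Real.exp 1)) *
    EReal.exp (((2 / (d : ℝ) : ℝ) : EReal) * diffEntropy μ)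

/-- `g` is a weak (distributional) gradient of `f` on `ℝᵈ`. -/
structure IsWeakGradient {d : ℕ} (f : EuclideanSpace ℝ (Fin d) → ℝ)
    (g : EuclideanSpace ℝ (Fin d) → EuclideanSpace ℝ (Fin d)) : Prop where
  locallyIntegrable_fun : LocallyIntegrable f volume
  locallyIntegrable_grad : LocallyIntegrable g volume
  integral_eq : ∀ η : EuclideanSpace ℝ (Fin d) → ℝ, ContDiff ℝ (⊤ : ℕ∞) η → HasCompactSupport η →
    ∀ v : EuclideanSpace ℝ (Fin d),
      ∫ x, f x * fderiv ℝ η x v = - ∫ x, inner ℝ (g x) v * η x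

/-- Fisher information `J = ∫ f |∇ log f|²`, where `∇ log f = f⁻¹ ∇f` and `∇f` is the weak gradient
of the density `f`. It is `∞` if there is no density or the density has no weak gradient
(the infimum is then over the empty set; otherwise the weak gradient is a.e. unique, and all
the competitors give the same value). -/
def fisherInfo {d : ℕ} (μ : Measure (EuclideanSpace ℝ (Fin d))) : ℝ≥0∞ :=
  ⨅ (_ : μ ≪ volume) (g : EuclideanSpace ℝ (Fin d) → EuclideanSpace ℝ (Fin d))
    (_ : IsWeakGradient (lebDensity μ) g),
    ∫⁻ x, ENNReal.ofReal (lebDensity μ x * ‖(lebDensity μ x)⁻¹ • g x‖ ^ 2)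

/-- The standard Gaussian measure on `ℝᵈ`, with density `(2π)^(-d/2) exp (-|x|²/2)`. -/
def stdGauss (d : ℕ) : Measure (EuclideanSpace ℝ (Fin d)) :=
  volume.withDensity fun x =>
    ENNReal.ofReal ((2 * Real.pi) ^ (-(d : ℝ) / 2) * Real.exp (-‖x‖ ^ 2 / 2))

/-- Entropy `D = ∫ f log (f / φ)` relative to the standard Gaussian, with values in `[0, ∞]`. -/
def relEntropy {d : ℕ} (μ : Measure (EuclideanSpace ℝ (Fin d))) : ℝ≥0∞ :=
  InformationTheory.klDiv μ (stdGauss d)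

/-- Fisher information `I = ∫ f |∇ log (f / φ)|²` relative to the standard Gaussian; here
`∇ log (f / φ) (x) = f(x)⁻¹ ∇f(x) + x`, with `∇f` the weak gradient of the density `f`. It is `∞` if
there is no density or the density has no weak gradient. -/
def relFisherInfo {d : ℕ} (μ : Measure (EuclideanSpace ℝ (Fin d))) : ℝ≥0∞ :=
  ⨅ (_ : μ ≪ volume) (g : EuclideanSpace ℝ (Fin d) → EuclideanSpace ℝ (Fin d))
    (_ : IsWeakGradient (lebDensity μ) g),
    ∫⁻ x, ENNReal.ofReal (lebDensity μ x * ‖(lebDensity μ x)⁻¹ • g x + x‖ ^ 2)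

/-- Stam defect `p = N J / d`, understood as `∞` whenever `J = ∞` (also when `N = 0`; this is the
reading under which `p ≥ 1` holds for every law). -/
def stamDefect {d : ℕ} (μ : Measure (EuclideanSpace ℝ (Fin d))) : ℝ≥0∞ :=
  open Classical in
  if fisherInfo μ = ∞ then ∞ else entropyPower μ * fisherInfo μ / (d : ℝ≥0∞)

/-- The interpolation inequality in dimension `d`: for independent centered random vectors `X`, `Y`
and all `θ ∈ [0, 1]`,
`D(X) + D(Y) ≤ (1-θ)/2 I(X) + θ/2 I(Y) + D(√θ X + √(1-θ) Y)`. -/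
def InterpolationInequality (d : ℕ) : Prop :=
  ∀ (Ω : Type u) [MeasurableSpace Ω] (P : Measure Ω) [IsProbabilityMeasure P]
    (X Y : Ω → EuclideanSpace ℝ (Fin d)),
    Measurable X → Measurable Y → IndepFun X Y P →
    Integrable X P → ∫ ω, X ω ∂P = 0 → Integrable Y P → ∫ ω, Y ω ∂P = 0 →
    ∀ θ : ℝ, 0 ≤ θ → θ ≤ 1 →
      relEntropy (P.map X) + relEntropy (P.map Y) ≤
        ENNReal.ofReal ((1 - θ) / 2) * relFisherInfo (P.map X)
          + ENNReal.ofReal (θ / 2) * relFisherInfo (P.map Y)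
          + relEntropy (P.map fun ω => √θ • X ω + √(1 - θ) • Y ω)

/-- The reverse entropy power inequality in dimension `d`: for independent random vectors `X`, `Y`
with finite second moments and `λ ∈ [0, 1]` (written `l`) with `λ / (1-λ) = N(Y) / N(X)`,
`N(X+Y) ≤ (N(X) + N(Y)) (λ p(X) + (1-λ) p(Y))`.
The ratios are taken in `[0, ∞]`, and `N(X)`, `N(Y)` are not both zero, so that exactly one `λ`
qualifies. -/
def ReverseEPI (d : ℕ) : Prop :=
  ∀ (Ω : Type u) [MeasurableSpace Ω] (P : Measure Ω) [IsProbabilityMeasure P]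
    (X Y : Ω → EuclideanSpace ℝ (Fin d)),
    Measurable X → Measurable Y → IndepFun X Y P → MemLp X 2 P → MemLp Y 2 P →
    (entropyPower (P.map X) ≠ 0 ∨ entropyPower (P.map Y) ≠ 0) →
    ∀ l : ℝ, 0 ≤ l → l ≤ 1 →
      ENNReal.ofReal l / ENNReal.ofReal (1 - l) =
        entropyPower (P.map Y) / entropyPower (P.map X) →
      entropyPower (P.map fun ω => X ω + Y ω) ≤
        (entropyPower (P.map X) + entropyPower (P.map Y)) *
          (ENNReal.ofReal l * stamDefect (P.map X)
            + ENNReal.ofReal (1 - l) * stamDefect (P.map Y))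

/-- The reverse Fisher information inequality in dimension `d`: for independent random vectors `X`,
`Y` with finite second moments and finite Fisher information,
`1/J(X+Y) ≤ (1/J(X) + 1/J(Y)) p(X) p(Y)`. -/
def ReverseFII (d : ℕ) : Prop :=
  ∀ (Ω : Type u) [MeasurableSpace Ω] (P : Measure Ω) [IsProbabilityMeasure P]
    (X Y : Ω → EuclideanSpace ℝ (Fin d)),
    Measurable X → Measurable Y → IndepFun X Y P → MemLp X 2 P → MemLp Y 2 P →
    fisherInfo (P.map X) < ∞ → fisherInfo (P.map Y) < ∞ →
      1 / fisherInfo (P.map fun ω => X ω + Y ω) ≤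
        (1 / fisherInfo (P.map X) + 1 / fisherInfo (P.map Y)) *
          (stamDefect (P.map X) * stamDefect (P.map Y))

end

/-! ### Directional weak derivatives of integrable functions and their vanishing on the zero set. -/

section WeakDerivative

variable {E : Type*} [NormedAddCommGroup E] [NormedSpace ℝ E] [FiniteDimensional ℝ E]
  [MeasurableSpace E] [BorelSpace E] {μ : Measure E} [μ.IsAddHaarMeasure]

/-! Both (A) and (B) are equivalent to one pair of statements. The first is the sum bound
`EntropySumBound`, which says N(X+Y) ≤ N(X) N(Y) (J(X)+J(Y))/d. The second is `StamInequality`, N J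
≥ d together with h > -∞ and J > 0 whenever J and the second moment are finite.

(B) and the sum bound: the prescribed weight is λ = N(Y)/(N(X)+N(Y)), and with it the right side of
(B) is exactly N(X) N(Y) (J(X)+J(Y))/d when all quantities are finite. Stam's inequality settles the
degenerate laws: it turns N = 0 into J = ∞, hence into an infinite defect. Conversely (B) implies
Stam's inequality: for an independent copy X' of X, N(aX') ≤ N(X+aX') ≤ N(X) N(aX')
(J(X)+J(X)/a²)/d, and one divides by N(aX') and lets a → ∞.

(A) and the sum bound: for finite second moment M, D = -h + (d/2) log 2π + M/2 and I = J - 2d + M.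
For centered independent X, Y the second moments cancel in (A) for every θ. What is left compares h
and J only, and (A) becomes the sum bound after linearization of the logarithm by log x ≤ x - 1. One
direction applies the sum bound to √θ X and √(1-θ) Y; the other takes θ = 1/2 and rescales so that
the linearization is sharp. The case θ = 0 with Gaussian Y is the logarithmic Sobolev inequality,
and optimizing it over dilations gives Stam's inequality.

(C) follows from the pair, since Stam's inequality for the sum gives 1/J(X+Y) ≤ N(X+Y)/d. It is not
needed to recover (A).

The analytic input is of three kinds. The formula for I (`relFisherInfo_add`) needs ∫⟨∇f, x⟩ = -d
and the fact that a weak gradient of a density vanishes almost everywhere where the density does.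
Since (A) assumes no second moments, they are extracted from I < ∞
(`sqMoment_lt_top_of_relFisherInfo`). Finally, h(X+Y) ≥ h(Y) is Jensen's inequality for t log t
(`diffEntropy_le_conv`). -/

theorem continuous_setIntegral_translate {G : E → ℝ} (hG : Integrable G μ) (A : Set E) (v : E) :
    Continuous fun s : ℝ => ∫ x in A, G (x + s • v) ∂μ := by
  -- Translations act continuously on L¹, and integration over `A` is continuous on L¹.
  let τ : C(ℝ, C(E, E)) :=
    (ContinuousMap.mk (fun p : ℝ × E => p.2 + p.1 • v) (by fun_prop)).curry
  have hτ : ∀ s, MeasurePreserving (τ s) μ μ := fun s => measurePreserving_add_right μ (s • v)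
  have hc := Continuous.compMeasurePreservingLp (p := 1)
    (continuous_const (y := hG.toL1 G)) τ.continuous hτ ENNReal.one_ne_top
  have := (continuous_setIntegral (E := ℝ) A).comp hc
  refine this.congr fun s => ?_
  refine integral_congr_ae (ae_restrict_of_ae ?_)
  filter_upwards [Lp.coeFn_compMeasurePreserving (hG.toL1 G) (hτ s),
    (hτ s).quasiMeasurePreserving.ae (Integrable.coeFn_toL1 hG)] with x hx hx'
  rw [hx]; exact hx'

theorem isFiniteMeasure_restrict_uIoc (a b : ℝ) :
    IsFiniteMeasure ((volume : Measure ℝ).restrict (Set.uIoc a b)) :=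
  ⟨by simp [Set.uIoc, Real.volume_Ioc]⟩

theorem integrable_prod_translate {G : E → ℝ} (hG : Integrable G μ) (v : E) (a b : ℝ) :
    Integrable (fun p : ℝ × E => G (p.2 + p.1 • v)) ((volume.restrict (Set.uIoc a b)).prod μ) := by
  have h : MeasurePreserving (fun p : ℝ × E => (p.1, p.2 + p.1 • v))
      ((volume.restrict (Set.uIoc a b)).prod μ) ((volume.restrict (Set.uIoc a b)).prod μ) :=
    (MeasurePreserving.id _).skew_product (g := fun s x => x + s • v) (by fun_prop)
      (ae_of_all _ fun s => (measurePreserving_add_right μ (s • v)).map_eq)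
  have := isFiniteMeasure_restrict_uIoc a b
  have h2 : Integrable (fun p : ℝ × E => G p.2) ((volume.restrict (Set.uIoc a b)).prod μ) :=
    hG.comp_snd _
  exact (h.integrable_comp h2.aestronglyMeasurable).2 h2

/-- A function with an integrable weak derivative is, along almost every line, the primitive of that
derivative. -/
theorem ae_sub_eq_intervalIntegral_of_weakDeriv {f G : E → ℝ} {v : E} (hf : Integrable f μ)
    (hG : Integrable G μ)
    (h : ∀ η : E → ℝ, ContDiff ℝ (⊤ : ℕ∞) η → HasCompactSupport η →
      ∫ x, f x * fderiv ℝ η x v ∂μ = - ∫ x, G x * η x ∂μ) (t : ℝ) :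
    ∀ᵐ x ∂μ, f (x + t • v) - f x = ∫ s in (0 : ℝ)..t, G (x + s • v) := by
  have hK : Integrable (fun x => ∫ s in (0 : ℝ)..t, G (x + s • v)) μ := by
    have := (integrable_prod_translate hG v 0 t).integral_prod_right
    simp only [intervalIntegral.intervalIntegral_eq_integral_uIoc]
    exact this.smul (if (0 : ℝ) ≤ t then (1 : ℝ) else -1)
  have hft : Integrable (fun x => f (x + t • v)) μ := hf.comp_add_right _
  refine ae_eq_of_integral_contDiff_smul_eq (hft.sub hf).locallyIntegrable hK.locallyIntegrable ?_
  -- Both sides are tested against `η`: the translation is moved onto `η`, its increment is written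
  -- as an integral of derivatives along `v`, the weak derivative identity is applied to each
  -- translate of `η`, and the translation is moved back.
  intro η hη hηc
  simp only [smul_eq_mul]
  have hηb : ∃ C, ∀ x, ‖η x‖ ≤ C := hηc.exists_bound_of_continuous hη.continuous
  obtain ⟨C, hC⟩ := hηb
  have hdc : Continuous fun x => fderiv ℝ η x v :=
    (hη.continuous_fderiv (by simp)).clm_apply continuous_const
  obtain ⟨C', hC'⟩ : ∃ C, ∀ x, ‖fderiv ℝ η x v‖ ≤ C :=
    ((hηc.fderiv (𝕜 := ℝ)).comp_left (g := fun L : E →L[ℝ] ℝ => L v) (by simp)).exists_bound_of_continuous hdc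
  have hs : ∀ s : ℝ, ContDiff ℝ (⊤ : ℕ∞) (fun x => η (x - s • v)) := fun s =>
    hη.comp (contDiff_id.sub contDiff_const)
  have hsc : ∀ s : ℝ, HasCompactSupport (fun x => η (x - s • v)) := fun s => by
    have := hηc.comp_homeomorph (Homeomorph.addRight (-(s • v)))
    simpa [Function.comp_def, sub_eq_add_neg] using this
  have hfd : ∀ (s : ℝ) x, fderiv ℝ (fun x => η (x - s • v)) x = fderiv ℝ η (x - s • v) := fun s x => by
    simp [fderiv_comp_sub]
  have hftc : ∀ x, η (x - t • v) - η x = ∫ s in (0 : ℝ)..t, - fderiv ℝ η (x - s • v) v := by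
    intro x
    have hd : ∀ s ∈ Set.uIcc 0 t, HasDerivAt (fun s : ℝ => η (x - s • v)) (- fderiv ℝ η (x - s • v) v) s := by
      intro s _
      have h1 : HasDerivAt (fun s : ℝ => x - s • v) (-v) s := by
        simpa using ((hasDerivAt_id s).smul_const v).const_sub x
      have h2 := ((hη.differentiable (by simp)) (x - s • v)).hasFDerivAt.comp_hasDerivAt s h1
      simpa [Function.comp_def] using h2
    rw [intervalIntegral.integral_eq_sub_of_hasDerivAt hd]
    · simp
    · exact ((hdc.comp (by fun_prop : Continuous fun s : ℝ => x - s • v)).neg).intervalIntegrable _ _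
  have e1 : ∫ x, η x * (f (x + t • v) - f x) ∂μ = ∫ x, f x * (η (x - t • v) - η x) ∂μ := by
    have i1 : Integrable (fun x => η x * f (x + t • v)) μ :=
      hft.bdd_mul hη.continuous.aestronglyMeasurable (ae_of_all _ hC)
    have i2 : Integrable (fun x => η x * f x) μ :=
      hf.bdd_mul hη.continuous.aestronglyMeasurable (ae_of_all _ hC)
    have i3 : Integrable (fun x => f x * η (x - t • v)) μ :=
      hf.mul_bdd (hs t).continuous.aestronglyMeasurable (ae_of_all _ fun x => hC _)
    have i4 : Integrable (fun x => f x * η x) μ := by simpa only [mul_comm] using i2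
    simp only [mul_sub]
    rw [integral_sub i1 i2, integral_sub i3 i4]
    congr 1
    · rw [← integral_add_right_eq_self (fun x => f x * η (x - t • v)) (t • v)]
      simp [mul_comm]
    · simp only [mul_comm]
  have e2 : ∫ x, f x * (η (x - t • v) - η x) ∂μ
      = ∫ s in (0 : ℝ)..t, ∫ x, f x * (- fderiv ℝ η (x - s • v) v) ∂μ := by
    simp only [hftc, ← intervalIntegral.integral_const_mul]
    have := isFiniteMeasure_restrict_uIoc 0 t
    rw [intervalIntegral_integral_swap]
    have : Integrable (fun p : ℝ × E => f p.2) ((volume.restrict (Set.uIoc 0 t)).prod μ) :=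
      hf.comp_snd _
    refine this.mul_bdd (c := C') ?_ (ae_of_all _ fun p => ?_)
    · exact ((hdc.comp (by fun_prop : Continuous fun p : ℝ × E => p.2 - p.1 • v)).neg).aestronglyMeasurable
    · simpa using hC' _
  have e3 : ∀ s : ℝ, ∫ x, f x * (- fderiv ℝ η (x - s • v) v) ∂μ = ∫ x, η x * G (x + s • v) ∂μ := by
    intro s
    have := h _ (hs s) (hsc s)
    simp only [hfd] at this
    simp only [mul_neg, integral_neg, this, neg_neg]
    rw [← integral_add_right_eq_self (fun x => G x * η (x - s • v)) (s • v)]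
    simp [mul_comm]
  rw [e1, e2]
  simp only [e3, ← intervalIntegral.integral_const_mul]
  rw [intervalIntegral_integral_swap]
  have := integrable_prod_translate hG v 0 t
  exact this.bdd_mul (c := C) (hη.continuous.comp continuous_snd).aestronglyMeasurable
    (ae_of_all _ fun p => hC _)

/-- From a zero of a nonnegative function every increment is nonnegative. Hence the primitive of s ↦
∫_A G(x + s v) is nonnegative for t > 0 and vanishes at t = 0; as the integrand is continuous in s,
its value at s = 0 is the right derivative there, so it is nonnegative. -/
theorem setIntegral_weakDeriv_nonneg {f G : E → ℝ} {v : E} (hf : Integrable f μ)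
    (hG : Integrable G μ) (hf0 : ∀ x, 0 ≤ f x)
    (h : ∀ η : E → ℝ, ContDiff ℝ (⊤ : ℕ∞) η → HasCompactSupport η →
      ∫ x, f x * fderiv ℝ η x v ∂μ = - ∫ x, G x * η x ∂μ) {A : Set E} (hA : MeasurableSet A)
    (hfA : ∀ x ∈ A, f x = 0) : 0 ≤ ∫ x in A, G x ∂μ := by
  have hc := continuous_setIntegral_translate hG A v
  set a : ℝ → ℝ := fun s => ∫ x in A, G (x + s • v) ∂μ with ha
  have hnn : ∀ t, 0 ≤ ∫ s in (0 : ℝ)..t, a s := by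
    intro t
    have e : ∫ s in (0 : ℝ)..t, a s = ∫ x in A, (∫ s in (0 : ℝ)..t, G (x + s • v)) ∂μ := by
      rw [ha, intervalIntegral_integral_swap]
      refine (integrable_prod_translate hG v 0 t).mono_measure ?_
      gcongr
      exact Measure.restrict_le_self
    rw [e, ← integral_congr_ae (ae_restrict_of_ae (ae_sub_eq_intervalIntegral_of_weakDeriv hf hG h t))]
    refine setIntegral_nonneg hA fun x hx => ?_
    rw [hfA x hx, sub_zero]
    exact hf0 _
  have hd : HasDerivAt (fun t => ∫ s in (0 : ℝ)..t, a s) (a 0) 0 :=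
    intervalIntegral.integral_hasDerivAt_right (hc.intervalIntegrable _ _)
      (hc.stronglyMeasurableAtFilter _ _) hc.continuousAt
  have h0 : 0 ≤ a 0 := by
    have := hd.hasDerivWithinAt (s := Set.Ioi 0)
    rw [hasDerivWithinAt_iff_tendsto_slope' (by simp)] at this
    refine ge_of_tendsto this ?_
    filter_upwards [self_mem_nhdsWithin] with t ht
    have ht' : (0:ℝ) < t := ht
    rw [slope_def_field]
    simp only [intervalIntegral.integral_same, sub_zero]
    exact div_nonneg (hnn t) ht'.le
  simpa [ha] using h0

/-- The one-sided bound applies to (`G`, `v`) and to (`-G`, `-v`), so `G` integrates to zero over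
every measurable part of the zero set. -/
theorem weakDeriv_eq_zero_on_zeros {f G : E → ℝ} {v : E} (hf : Integrable f μ)
    (hG : Integrable G μ) (hf0 : ∀ x, 0 ≤ f x) (hfm : Measurable f)
    (h : ∀ η : E → ℝ, ContDiff ℝ (⊤ : ℕ∞) η → HasCompactSupport η →
      ∫ x, f x * fderiv ℝ η x v ∂μ = - ∫ x, G x * η x ∂μ) :
    ∀ᵐ x ∂μ, f x = 0 → G x = 0 := by
  have hZ : MeasurableSet {x | f x = 0} := hfm (measurableSet_singleton 0)
  have : G =ᵐ[μ.restrict {x | f x = 0}] 0 := by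
    refine Integrable.ae_eq_zero_of_forall_setIntegral_eq_zero hG.restrict fun s hs _ => ?_
    rw [Measure.restrict_restrict hs]
    have hA := hs.inter hZ
    refine le_antisymm ?_ (setIntegral_weakDeriv_nonneg hf hG hf0 h hA fun x hx => hx.2)
    have := setIntegral_weakDeriv_nonneg (G := fun x => - G x) (v := -v) hf hG.neg hf0
      (fun η h1 h2 => by simp [integral_neg, h η h1 h2]) hA fun x hx => hx.2
    rw [integral_neg] at this
    linarith
  exact (ae_restrict_iff' hZ).1 this

end WeakDerivative

/-! ### Dilated cutoff functions. -/

section DilatedCutoff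

variable {E : Type*} [NormedAddCommGroup E] [InnerProductSpace ℝ E] [FiniteDimensional ℝ E]

/-- Smooth compactly supported cutoffs that are eventually `1` at every point, with uniformly bounded radial
derivative. -/
theorem exists_dilated_cutoff : ∃ (χ : ℕ → E → ℝ) (C : ℝ),
    (∀ n, ContDiff ℝ (⊤ : ℕ∞) (χ n)) ∧ (∀ n, HasCompactSupport (χ n)) ∧
    (∀ n x, 0 ≤ χ n x) ∧ (∀ n x, χ n x ≤ 1) ∧ (∀ n x, |fderiv ℝ (χ n) x x| ≤ C) ∧
    ∀ x, ∀ᶠ n in Filter.atTop, χ n x = 1 ∧ fderiv ℝ (χ n) x = 0 := by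
  -- The cutoffs are dilates of a single bump. The radial derivative ⟨∇b(y), y⟩ is invariant under
  -- dilation, so its bound does not depend on `n`.
  let b : ContDiffBump (0 : E) := ⟨1, 2, one_pos, one_lt_two⟩
  have hb : ContDiff ℝ (⊤ : ℕ∞) b := b.contDiff
  have hpos : ∀ n : ℕ, ((n : ℝ) + 1)⁻¹ ≠ 0 := fun n => by positivity
  have hk : Continuous fun y => fderiv ℝ b y y :=
    (hb.continuous_fderiv (by simp)).clm_apply continuous_id
  have hkc : HasCompactSupport fun y => fderiv ℝ b y y :=
    (b.hasCompactSupport.fderiv (𝕜 := ℝ)).mono fun y hy => by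
      simp only [Function.mem_support, ne_eq] at hy ⊢
      intro h0; exact hy (by rw [h0]; rfl)
  obtain ⟨C, hC⟩ := hkc.exists_bound_of_continuous hk
  refine ⟨fun n x => b (((n : ℝ) + 1)⁻¹ • x), C, fun n => hb.comp (contDiff_const_smul _),
    fun n => ?_, fun n x => b.nonneg, fun n x => b.le_one, fun n x => ?_, fun x => ?_⟩
  · exact b.hasCompactSupport.comp_homeomorph (Homeomorph.smulOfNeZero _ (hpos n))
  · have := hC (((n : ℝ) + 1)⁻¹ • x)
    rw [fderiv_comp_smul]
    simpa using this
  · obtain ⟨N, hN⟩ := exists_nat_gt ‖x‖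
    filter_upwards [Filter.eventually_ge_atTop N] with n hn
    have hn' : (N : ℝ) ≤ n := by exact_mod_cast hn
    have hev : (fun y : E => b (((n : ℝ) + 1)⁻¹ • y)) =ᶠ[nhds x] fun _ => 1 := by
      have : ∀ᶠ y in nhds x, ‖y‖ < (n : ℝ) + 1 :=
        (continuous_norm.tendsto x).eventually (gt_mem_nhds (by linarith))
      filter_upwards [this] with y hy
      refine b.one_of_mem_closedBall ?_
      rw [mem_closedBall_zero_iff, norm_smul, norm_inv, Real.norm_of_nonneg (by positivity)]
      show _ ≤ (1 : ℝ)
      rw [inv_mul_le_iff₀ (by positivity)]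
      linarith
    exact ⟨hev.self_of_nhds, by rw [hev.fderiv_eq]; simp⟩

end DilatedCutoff

/-! ### Weak gradients: zero set and the divergence identity. -/

section WeakGradient

variable {d : ℕ} {f : EuclideanSpace ℝ (Fin d) → ℝ}
  {g : EuclideanSpace ℝ (Fin d) → EuclideanSpace ℝ (Fin d)}

theorem IsWeakGradient.locallyIntegrable_inner (h : IsWeakGradient f g)
    (v : EuclideanSpace ℝ (Fin d)) : LocallyIntegrable (fun x => inner ℝ (g x) v) volume := by
  intro x
  obtain ⟨U, hU, hi⟩ := h.locallyIntegrable_grad x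
  exact ⟨U, hU, hi.inner_const v⟩

theorem MeasureTheory.LocallyIntegrable.integrable_mul_test {X : Type*} [TopologicalSpace X] [T2Space X] [MeasurableSpace X]
    [OpensMeasurableSpace X] {μ : Measure X} {f η : X → ℝ} (hf : LocallyIntegrable f μ)
    (hη : Continuous η) (hc : HasCompactSupport η) : Integrable (fun x => f x * η x) μ := by
  have := hf.integrable_smul_left_of_hasCompactSupport hη hc
  simpa [mul_comm] using this

theorem hasCompactSupport_fderiv_apply {E : Type*} [NormedAddCommGroup E] [NormedSpace ℝ E]
    {η : E → ℝ} (hη : HasCompactSupport η) (V : E → E) :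
    HasCompactSupport fun x => fderiv ℝ η x (V x) :=
  (hη.fderiv (𝕜 := ℝ)).mono fun y hy => by
    simp only [Function.mem_support, ne_eq] at hy ⊢
    intro h0; exact hy (by rw [h0]; rfl)

/-- A weak gradient of a nonnegative function vanishes almost everywhere on its zero set. -/
theorem IsWeakGradient.ae_eq_zero (h : IsWeakGradient f g) (hfm : Measurable f)
    (hf0 : ∀ x, 0 ≤ f x) : ∀ᵐ x, f x = 0 → g x = 0 := by
  obtain ⟨χ, C, hs, hc, h0, h1, -, hev⟩ :=
    exists_dilated_cutoff (E := EuclideanSpace ℝ (Fin d))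
  -- `f` and `g` are only locally integrable, so the result for integrable functions is applied to
  -- `f * χ n`, whose weak derivative is given by the product rule. Where `χ n` equals 1 with zero
  -- derivative, this is the claim for `f`.
  have key : ∀ (n : ℕ) (v : EuclideanSpace ℝ (Fin d)), ∀ᵐ x, f x * χ n x = 0 →
      inner ℝ (g x) v * χ n x + f x * fderiv ℝ (χ n) x v = 0 := by
    intro n v
    have hdc : Continuous fun x => fderiv ℝ (χ n) x v :=
      ((hs n).continuous_fderiv (by simp)).clm_apply continuous_const
    have i1 : Integrable (fun x => f x * χ n x) :=
      h.locallyIntegrable_fun.integrable_mul_test (hs n).continuous (hc n)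
    have i2 : Integrable (fun x => inner ℝ (g x) v * χ n x) :=
      (h.locallyIntegrable_inner v).integrable_mul_test (hs n).continuous (hc n)
    have i3 : Integrable (fun x => f x * fderiv ℝ (χ n) x v) :=
      h.locallyIntegrable_fun.integrable_mul_test hdc (hasCompactSupport_fderiv_apply (hc n) fun _ => v)
    refine weakDeriv_eq_zero_on_zeros (v := v) i1 (i2.add i3)
      (fun x => mul_nonneg (hf0 x) (h0 n x)) (hfm.mul (hs n).continuous.measurable) ?_
    intro η hη hηc
    have hηd : Continuous fun x => fderiv ℝ η x v :=
      (hη.continuous_fderiv (by simp)).clm_apply continuous_const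
    have hw := h.integral_eq (fun x => χ n x * η x) ((hs n).mul hη) (hηc.mul_left) v
    have hfd : ∀ x, fderiv ℝ (fun x => χ n x * η x) x v
        = χ n x * fderiv ℝ η x v + η x * fderiv ℝ (χ n) x v := by
      intro x
      rw [fderiv_fun_mul ((hs n).differentiable (by simp) x) (hη.differentiable (by simp) x)]
      simp
    simp only [hfd, mul_add] at hw
    have j1 : Integrable (fun x => f x * (χ n x * fderiv ℝ η x v)) :=
      h.locallyIntegrable_fun.integrable_mul_test ((hs n).continuous.mul hηd) (hc n).mul_right
    have j2 : Integrable (fun x => f x * (η x * fderiv ℝ (χ n) x v)) :=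
      h.locallyIntegrable_fun.integrable_mul_test (hη.continuous.mul hdc) hηc.mul_right
    have j3 : Integrable (fun x => inner ℝ (g x) v * (χ n x * η x)) :=
      (h.locallyIntegrable_inner v).integrable_mul_test ((hs n).continuous.mul hη.continuous)
        (hc n).mul_right
    rw [integral_add j1 j2] at hw
    have e1 : ∫ x, f x * χ n x * fderiv ℝ η x v = ∫ x, f x * (χ n x * fderiv ℝ η x v) := by
      simp only [mul_assoc]
    have e2 : ∫ x, (inner ℝ (g x) v * χ n x + f x * fderiv ℝ (χ n) x v) * η x
        = (∫ x, inner ℝ (g x) v * (χ n x * η x)) + ∫ x, f x * (η x * fderiv ℝ (χ n) x v) := by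
      rw [← integral_add j3 j2]
      congr 1; ext x; ring
    rw [e1, e2]
    linarith
  have key' : ∀ᵐ x, ∀ (n : ℕ) (i : Fin d), f x * χ n x = 0 →
      inner ℝ (g x) (EuclideanSpace.basisFun (Fin d) ℝ i) * χ n x
        + f x * fderiv ℝ (χ n) x (EuclideanSpace.basisFun (Fin d) ℝ i) = 0 :=
    ae_all_iff.2 fun n => ae_all_iff.2 fun i => key n _
  filter_upwards [key'] with x hx hfx
  obtain ⟨n, hn1, hn2⟩ := (hev x).exists
  ext i
  simpa [hfx, hn1, hn2, EuclideanSpace.inner_single_right] using hx n i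

/-- Sum over the coordinates i of the weak gradient identity in direction e_i with test function x_i
η; the divergence of x η is d η + ⟨∇η, x⟩. -/
theorem IsWeakGradient.integral_divergence (h : IsWeakGradient f g)
    {η : EuclideanSpace ℝ (Fin d) → ℝ} (hη : ContDiff ℝ (⊤ : ℕ∞) η) (hc : HasCompactSupport η) :
    ∫ x, f x * (d * η x + fderiv ℝ η x x) = - ∫ x, inner ℝ (g x) x * η x := by
  let e := EuclideanSpace.basisFun (Fin d) ℝ
  have hcoord : ∀ i, ContDiff ℝ (⊤ : ℕ∞) (fun x : EuclideanSpace ℝ (Fin d) => x i) := fun i =>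
    (EuclideanSpace.proj (𝕜 := ℝ) i).contDiff
  have hfd : ∀ i x, fderiv ℝ (fun x => x i * η x) x (e i) = η x + x i * fderiv ℝ η x (e i) := by
    intro i x
    rw [fderiv_fun_mul ((hcoord i).differentiable (by simp) x) (hη.differentiable (by simp) x)]
    have : fderiv ℝ (fun x : EuclideanSpace ℝ (Fin d) => x i) x (e i) = 1 := by
      have h2 : fderiv ℝ (fun x : EuclideanSpace ℝ (Fin d) => x i) x
        = (EuclideanSpace.proj i : EuclideanSpace ℝ (Fin d) →L[ℝ] ℝ) :=
        (EuclideanSpace.proj i : EuclideanSpace ℝ (Fin d) →L[ℝ] ℝ).fderiv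
      rw [h2]; simp [e]
    simp [this]; ring
  have hi : ∀ i, ∫ x, f x * (η x + x i * fderiv ℝ η x (e i))
      = - ∫ x, inner ℝ (g x) (e i) * (x i * η x) := by
    intro i
    have := h.integral_eq (fun x => x i * η x) ((hcoord i).mul hη) hc.mul_left (e i)
    simpa only [hfd] using this
  have hx : ∀ x : EuclideanSpace ℝ (Fin d), ∑ i, x i • e i = x := fun x => by
    simpa [e] using (EuclideanSpace.basisFun (Fin d) ℝ).sum_repr x
  have i1 : ∀ i, Integrable (fun x => f x * (η x + x i * fderiv ℝ η x (e i))) := fun i => by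
    have hηd : Continuous fun x => fderiv ℝ η x (e i) :=
      (hη.continuous_fderiv (by simp)).clm_apply continuous_const
    refine h.locallyIntegrable_fun.integrable_mul_test
      (hη.continuous.add ((hcoord i).continuous.mul hηd)) ?_
    exact hc.add (hasCompactSupport_fderiv_apply hc fun _ => e i).mul_left
  have i2 : ∀ i, Integrable (fun x => inner ℝ (g x) (e i) * (x i * η x)) := fun i =>
    (h.locallyIntegrable_inner _).integrable_mul_test
      ((hcoord i).continuous.mul hη.continuous) hc.mul_left
  have e1 : ∀ x, f x * (d * η x + fderiv ℝ η x x)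
      = ∑ i, f x * (η x + x i * fderiv ℝ η x (e i)) := by
    intro x
    have hl : fderiv ℝ η x x = ∑ i, x i * fderiv ℝ η x (e i) := by
      conv_lhs => rw [← hx x, map_sum]
      simp [hx]
    rw [← Finset.mul_sum, Finset.sum_add_distrib, hl]
    simp
  have e2 : ∀ x, inner ℝ (g x) x * η x = ∑ i, inner ℝ (g x) (e i) * (x i * η x) := by
    intro x
    nth_rewrite 2 [← hx x]
    rw [inner_sum, Finset.sum_mul]
    refine Finset.sum_congr rfl fun i _ => ?_
    rw [inner_smul_right]; ring
  simp only [e1, e2]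
  rw [integral_finsetSum _ fun i _ => i1 i, integral_finsetSum _ fun i _ => i2 i,
    ← Finset.sum_neg_distrib]
  exact Finset.sum_congr rfl fun i _ => hi i

/-- Take the cutoffs as test functions in the divergence identity. Their radial derivatives are
uniformly bounded and tend to zero pointwise, so dominated convergence applies. This evaluates the
cross term of the relative Fisher information. -/
theorem IsWeakGradient.integral_inner_id (h : IsWeakGradient f g) (hf : Integrable f)
    (hi : Integrable fun x => inner ℝ (g x) x) :
    ∫ x, inner ℝ (g x) x = - (d * ∫ x, f x) := by
  obtain ⟨χ, C, hs, hc, h0, h1, hC, hev⟩ :=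
    exists_dilated_cutoff (E := EuclideanSpace ℝ (Fin d))
  have l1 : Filter.Tendsto (fun n => ∫ x, inner ℝ (g x) x * χ n x) Filter.atTop
      (nhds (∫ x, inner ℝ (g x) x)) := by
    refine tendsto_integral_of_dominated_convergence (fun x => ‖inner ℝ (g x) x‖)
      (fun n => hi.aestronglyMeasurable.mul (hs n).continuous.aestronglyMeasurable) hi.norm
      (fun n => ae_of_all _ fun x => ?_) (ae_of_all _ fun x => ?_)
    · rw [norm_mul, Real.norm_of_nonneg (h0 n x)]
      exact mul_le_of_le_one_right (norm_nonneg _) (h1 n x)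
    · refine tendsto_const_nhds.congr' ?_
      filter_upwards [hev x] with n hn
      simp [hn.1]
  have l2 : Filter.Tendsto (fun n => ∫ x, f x * (d * χ n x + fderiv ℝ (χ n) x x)) Filter.atTop
      (nhds (∫ x, f x * d)) := by
    refine tendsto_integral_of_dominated_convergence (fun x => ‖f x‖ * (d + C))
      (fun n => ?_) (hf.norm.mul_const _)
      (fun n => ae_of_all _ fun x => ?_) (ae_of_all _ fun x => ?_)
    · have hηd : Continuous fun x => fderiv ℝ (χ n) x x :=
        ((hs n).continuous_fderiv (by simp)).clm_apply continuous_id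
      exact hf.aestronglyMeasurable.mul
        ((continuous_const.mul (hs n).continuous).add hηd).aestronglyMeasurable
    · rw [norm_mul]
      refine mul_le_mul_of_nonneg_left ((norm_add_le _ _).trans (add_le_add ?_ (hC n x)))
        (norm_nonneg _)
      rw [norm_mul, Real.norm_of_nonneg (h0 n x), Real.norm_of_nonneg (Nat.cast_nonneg d)]
      exact mul_le_of_le_one_right (Nat.cast_nonneg d) (h1 n x)
    · refine tendsto_const_nhds.congr' ?_
      filter_upwards [hev x] with n hn
      simp [hn.1, hn.2]
  have l3 := l2.congr fun n => h.integral_divergence (hs n) (hc n)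
  have := tendsto_nhds_unique l3 l1.neg
  rw [integral_mul_const] at this
  linarith

end WeakGradient

/-! ### Lebesgue densities, second moments and affine changes of variables. -/

section Density

variable {d : ℕ} {μ : Measure (EuclideanSpace ℝ (Fin d))}

/-- The second moment of a measure. -/
noncomputable def sqMoment (μ : Measure (EuclideanSpace ℝ (Fin d))) : ℝ≥0∞ :=
  ∫⁻ x, ENNReal.ofReal (‖x‖ ^ 2) ∂μ

theorem measurable_lebDensity : Measurable (lebDensity μ) :=
  (Measure.measurable_rnDeriv _ _).ennreal_toReal

theorem lebDensity_nonneg (x : EuclideanSpace ℝ (Fin d)) : 0 ≤ lebDensity μ x :=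
  ENNReal.toReal_nonneg

theorem ofReal_lebDensity [IsFiniteMeasure μ] :
    (fun x => ENNReal.ofReal (lebDensity μ x)) =ᵐ[volume] μ.rnDeriv volume := by
  filter_upwards [μ.rnDeriv_lt_top volume] with x hx
  exact ENNReal.ofReal_toReal hx.ne

theorem lintegral_ofReal_lebDensity_mul [IsFiniteMeasure μ] (hμ : μ ≪ volume)
    {φ : EuclideanSpace ℝ (Fin d) → ℝ} (hφ : Measurable φ) :
    ∫⁻ x, ENNReal.ofReal (lebDensity μ x * φ x) = ∫⁻ x, ENNReal.ofReal (φ x) ∂μ := by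
  rw [← lintegral_rnDeriv_mul hμ (f := fun x => ENNReal.ofReal (φ x)) (by fun_prop)]
  refine lintegral_congr_ae ?_
  filter_upwards [ofReal_lebDensity (μ := μ)] with x hx
  rw [ENNReal.ofReal_mul (lebDensity_nonneg x), hx]

theorem integrable_lebDensity [IsFiniteMeasure μ] : Integrable (lebDensity μ) :=
  Measure.integrable_toReal_rnDeriv

theorem integral_lebDensity [IsProbabilityMeasure μ] (hμ : μ ≪ volume) :
    ∫ x, lebDensity μ x = 1 := by
  have := Measure.integral_toReal_rnDeriv hμ
  simpa [lebDensity] using this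

theorem lintegral_lebDensity_mul_sq [IsFiniteMeasure μ] (hμ : μ ≪ volume) :
    ∫⁻ x, ENNReal.ofReal (lebDensity μ x * ‖x‖ ^ 2) = sqMoment μ :=
  lintegral_ofReal_lebDensity_mul hμ (by fun_prop)

theorem integrable_lebDensity_mul_sq [IsFiniteMeasure μ] (hμ : μ ≪ volume)
    (hM : sqMoment μ < ∞) : Integrable (fun x => lebDensity μ x * ‖x‖ ^ 2) := by
  refine ⟨(measurable_lebDensity.mul (by fun_prop)).aestronglyMeasurable, ?_⟩
  rw [hasFiniteIntegral_iff_ofReal (ae_of_all _ fun x =>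
    mul_nonneg (lebDensity_nonneg x) (sq_nonneg _)), lintegral_lebDensity_mul_sq hμ]
  exact hM

theorem integral_lebDensity_mul_sq [IsFiniteMeasure μ] (hμ : μ ≪ volume) :
    ∫ x, lebDensity μ x * ‖x‖ ^ 2 = (sqMoment μ).toReal := by
  rw [integral_eq_lintegral_of_nonneg_ae (ae_of_all _ fun x =>
    mul_nonneg (lebDensity_nonneg x) (sq_nonneg _))
    (measurable_lebDensity.mul (by fun_prop)).aestronglyMeasurable, lintegral_lebDensity_mul_sq hμ]

theorem lebDensity_withDensity {φ : EuclideanSpace ℝ (Fin d) → ℝ≥0∞} (hφ : Measurable φ) :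
    lebDensity (volume.withDensity φ) =ᵐ[volume] fun x => (φ x).toReal := by
  filter_upwards [Measure.rnDeriv_withDensity volume hφ] with x hx
  rw [lebDensity, hx]

theorem lintegral_comp_affine {a : ℝ} (ha : 0 < a) (b : EuclideanSpace ℝ (Fin d))
    (φ : EuclideanSpace ℝ (Fin d) → ℝ≥0∞) :
    ∫⁻ y, φ (a⁻¹ • (y - b)) = ENNReal.ofReal (a ^ d) * ∫⁻ x, φ x := by
  rw [lintegral_sub_right_eq_self (fun y => φ (a⁻¹ • y)) b]
  have h := lintegral_map_equiv (μ := (volume : Measure (EuclideanSpace ℝ (Fin d)))) φ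
    (MeasurableEquiv.smul₀ a⁻¹ (inv_ne_zero ha.ne'))
  have h2 := Measure.map_addHaar_smul (volume : Measure (EuclideanSpace ℝ (Fin d)))
    (inv_ne_zero ha.ne')
  simp only [MeasurableEquiv.coe_smul₀] at h
  rw [← h, h2, lintegral_smul_measure]
  simp [abs_of_pos (pow_pos ha d)]

theorem integral_comp_affine {F : Type*} [NormedAddCommGroup F] [NormedSpace ℝ F] {a : ℝ}
    (ha : 0 < a) (b : EuclideanSpace ℝ (Fin d)) (φ : EuclideanSpace ℝ (Fin d) → F) :
    ∫ y, φ (a⁻¹ • (y - b)) = a ^ d • ∫ x, φ x := by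
  rw [integral_sub_right_eq_self (fun y => φ (a⁻¹ • y)) b,
    Measure.integral_comp_inv_smul]
  simp [abs_of_pos (pow_pos ha d)]

theorem integrable_comp_affine {F : Type*} [NormedAddCommGroup F] {a : ℝ} (ha : 0 < a)
    (b : EuclideanSpace ℝ (Fin d)) {φ : EuclideanSpace ℝ (Fin d) → F} (hφ : Integrable φ) :
    Integrable fun y => φ (a⁻¹ • (y - b)) := by
  have h : Integrable fun y => φ (a⁻¹ • y) := (integrable_comp_smul_iff volume φ (inv_ne_zero ha.ne')).2 hφ
  exact h.comp_sub_right b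

theorem map_affine_eq_withDensity [IsFiniteMeasure μ] (hμ : μ ≪ volume) {a : ℝ} (ha : 0 < a)
    (b : EuclideanSpace ℝ (Fin d)) :
    μ.map (fun x => a • x + b) = volume.withDensity fun y =>
      ENNReal.ofReal ((a ^ d)⁻¹) * μ.rnDeriv volume (a⁻¹ • (y - b)) := by
  ext s hs
  have hm : Measurable fun x : EuclideanSpace ℝ (Fin d) => a • x + b := by fun_prop
  have hr := Measure.measurable_rnDeriv μ volume
  rw [Measure.map_apply hm hs, withDensity_apply _ hs, lintegral_const_mul _ (by fun_prop),
    ← lintegral_indicator hs]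
  have : ∀ y, s.indicator (fun y => μ.rnDeriv volume (a⁻¹ • (y - b))) y
      = (fun x => ((fun x => a • x + b) ⁻¹' s).indicator (μ.rnDeriv volume) x) (a⁻¹ • (y - b)) := by
    intro y
    have hy : a • a⁻¹ • (y - b) + b = y := by
      rw [smul_inv_smul₀ ha.ne', sub_add_cancel]
    by_cases h : y ∈ s <;> simp [Set.indicator, hy, h]
  simp only [this]
  rw [lintegral_comp_affine ha b, lintegral_indicator (hm hs), ← mul_assoc,
    ← ENNReal.ofReal_mul (by positivity), inv_mul_cancel₀ (by positivity), ENNReal.ofReal_one,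
    one_mul, ← withDensity_apply _ (hm hs), Measure.withDensity_rnDeriv_eq _ _ hμ]

theorem map_affine_absolutelyContinuous [IsFiniteMeasure μ] (hμ : μ ≪ volume) {a : ℝ} (ha : 0 < a)
    (b : EuclideanSpace ℝ (Fin d)) : μ.map (fun x => a • x + b) ≪ volume := by
  rw [map_affine_eq_withDensity hμ ha b]
  exact withDensity_absolutelyContinuous _ _

theorem lebDensity_map_affine [IsFiniteMeasure μ] (hμ : μ ≪ volume) {a : ℝ} (ha : 0 < a)
    (b : EuclideanSpace ℝ (Fin d)) :
    lebDensity (μ.map fun x => a • x + b) =ᵐ[volume] fun y =>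
      (a ^ d)⁻¹ * lebDensity μ (a⁻¹ • (y - b)) := by
  have hr := Measure.measurable_rnDeriv μ volume
  rw [map_affine_eq_withDensity hμ ha b]
  filter_upwards [lebDensity_withDensity (d := d) (φ := fun y =>
      ENNReal.ofReal ((a ^ d)⁻¹) * μ.rnDeriv volume (a⁻¹ • (y - b))) (by fun_prop)] with y hy
  rw [hy, ENNReal.toReal_mul, ENNReal.toReal_ofReal (by positivity), lebDensity]

end Density

/-! ### Fisher information: scaling, second moments, relative versus absolute. -/

section Fisher

variable {d : ℕ} {μ : Measure (EuclideanSpace ℝ (Fin d))}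

/-- The rescaled field y ↦ a^(-d-1) g((y-b)/a) is a weak gradient of the transported density and so
competes in the infimum. Only this inequality is used later, because Fisher information always
enters as an upper bound. -/
theorem fisherInfo_map_affine_le [IsFiniteMeasure μ] {a : ℝ} (ha : 0 < a)
    (b : EuclideanSpace ℝ (Fin d)) :
    fisherInfo (μ.map fun x => a • x + b) ≤ ENNReal.ofReal ((a ^ 2)⁻¹) * fisherInfo μ := by
  have hc : ENNReal.ofReal ((a ^ 2)⁻¹) ≠ ∞ := ENNReal.ofReal_ne_top
  unfold fisherInfo
  have hne : ENNReal.ofReal ((a ^ 2)⁻¹) ≠ 0 := by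
    simp only [ne_eq, ENNReal.ofReal_eq_zero, not_le]; positivity
  simp only [ENNReal.mul_iInf_of_ne hne hc]
  refine le_iInf fun hμ => le_iInf fun g => le_iInf fun hg => ?_
  set f := lebDensity μ with hf
  set c : ℝ := (a ^ d)⁻¹ with hcdef
  have hcpos : 0 < c := by positivity
  have hdens := lebDensity_map_affine hμ ha b
  let g' : EuclideanSpace ℝ (Fin d) → EuclideanSpace ℝ (Fin d) :=
    fun y => (c * a⁻¹) • g (a⁻¹ • (y - b))
  have hwg : IsWeakGradient (lebDensity (μ.map fun x => a • x + b)) g' := by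
    refine ⟨integrable_lebDensity.locallyIntegrable, ?_, ?_⟩
    · rw [locallyIntegrable_iff]
      intro K hK
      set S : EuclideanSpace ℝ (Fin d) → EuclideanSpace ℝ (Fin d) := fun y => a⁻¹ • (y - b)
      have hSK : IsCompact (S '' K) := hK.image (by fun_prop)
      have h1 := (hg.locallyIntegrable_grad.integrableOn_isCompact hSK)
      have h2 : Integrable ((S '' K).indicator g) :=
        (integrable_indicator_iff hSK.measurableSet).2 h1
      have h3 := (integrable_comp_affine ha b h2).integrableOn (s := K)
      have h4 : IntegrableOn (fun y => g (a⁻¹ • (y - b))) K := by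
        refine h3.congr_fun (fun y hy => ?_) hK.measurableSet
        exact Set.indicator_of_mem (Set.mem_image_of_mem S hy) g
      exact Integrable.smul (c * a⁻¹) h4
    · intro η hη hηc v
      have hηT : ContDiff ℝ (⊤ : ℕ∞) (fun x => η (a • x + b)) := by fun_prop
      have hηTc : HasCompactSupport (fun x => η (a • x + b)) :=
        hηc.comp_homeomorph ((Homeomorph.smulOfNeZero a ha.ne').trans (Homeomorph.addRight b))
      have hw := hg.integral_eq _ hηT hηTc v
      have hfd : ∀ x, fderiv ℝ (fun x => η (a • x + b)) x v = a * fderiv ℝ η (a • x + b) v := by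
        intro x
        have h1 : HasFDerivAt (fun x : EuclideanSpace ℝ (Fin d) => a • x + b)
            (a • ContinuousLinearMap.id ℝ _) x :=
          ((hasFDerivAt_id x).const_smul a).add_const b
        have h2 := ((hη.differentiable (by simp)) (a • x + b)).hasFDerivAt.comp x h1
        have h3 : fderiv ℝ (fun x => η (a • x + b)) x = _ := h2.fderiv
        rw [h3]; simp
      simp only [hfd] at hw
      have hT : ∀ y : EuclideanSpace ℝ (Fin d), a • a⁻¹ • (y - b) + b = y := fun y => by
        rw [smul_inv_smul₀ ha.ne', sub_add_cancel]
      have e1 : ∫ y, lebDensity (μ.map fun x => a • x + b) y * fderiv ℝ η y v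
          = a ^ d • ∫ x, c * (f x * fderiv ℝ η (a • x + b) v) := by
        rw [← integral_comp_affine ha b fun x => c * (f x * fderiv ℝ η (a • x + b) v)]
        refine integral_congr_ae ?_
        filter_upwards [hdens] with y hy
        simp only [hy, hT]; ring
      have e2 : ∫ y, inner ℝ (g' y) v * η y
          = a ^ d • ∫ x, (c * a⁻¹) * (inner ℝ (g x) v * η (a • x + b)) := by
        rw [← integral_comp_affine ha b fun x => (c * a⁻¹) * (inner ℝ (g x) v * η (a • x + b))]
        refine integral_congr_ae (ae_of_all _ fun y => ?_)
        simp only [hT, g', real_inner_smul_left]; ring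
      rw [e1, e2, integral_const_mul, integral_const_mul]
      have hw' : a * ∫ x, f x * fderiv ℝ η (a • x + b) v
          = - ∫ x, inner ℝ (g x) v * η (a • x + b) := by
        rw [← hw, ← integral_const_mul]
        congr 1; ext x; ring
      have : ∫ x, f x * fderiv ℝ η (a • x + b) v
          = a⁻¹ * - ∫ x, inner ℝ (g x) v * η (a • x + b) := by
        rw [← hw']; field_simp
      rw [this]; simp only [smul_eq_mul]; ring
  refine ((iInf_le _ (map_affine_absolutelyContinuous hμ ha b)).trans
    ((iInf_le _ g').trans (iInf_le _ hwg))).trans (le_of_eq ?_)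
  have e : ∫⁻ y, ENNReal.ofReal (lebDensity (μ.map fun x => a • x + b) y *
        ‖(lebDensity (μ.map fun x => a • x + b) y)⁻¹ • g' y‖ ^ 2)
      = ENNReal.ofReal (a ^ d) * ∫⁻ x, ENNReal.ofReal (c * (a ^ 2)⁻¹) *
          ENNReal.ofReal (f x * ‖(f x)⁻¹ • g x‖ ^ 2) := by
    rw [← lintegral_comp_affine ha b fun x => ENNReal.ofReal (c * (a ^ 2)⁻¹) *
          ENNReal.ofReal (f x * ‖(f x)⁻¹ • g x‖ ^ 2)]
    refine lintegral_congr_ae ?_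
    filter_upwards [hdens] with y hy
    have hcancel : ((c * f (a⁻¹ • (y - b)))⁻¹ * (c * a⁻¹)) = a⁻¹ * (f (a⁻¹ • (y - b)))⁻¹ := by
      rw [mul_inv]; field_simp
    simp only [hy, g']
    rw [← ENNReal.ofReal_mul (by positivity), smul_smul, hcancel, mul_smul, norm_smul a⁻¹, mul_pow,
      Real.norm_of_nonneg (inv_nonneg.2 ha.le), inv_pow]
    congr 1; ring
  rw [e, lintegral_const_mul' _ _ ENNReal.ofReal_ne_top, ← mul_assoc,
    ← ENNReal.ofReal_mul (by positivity)]
  congr 2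
  rw [hcdef]; field_simp

/-- A law with finite relative Fisher information has a finite second moment. -/
theorem sqMoment_lt_top_of_relFisherInfo [IsProbabilityMeasure μ] (h : relFisherInfo μ < ∞) :
    sqMoment μ < ∞ := by
  simp only [relFisherInfo, iInf_lt_iff] at h
  obtain ⟨hμ, g, hg, hlt⟩ := h
  set f := lebDensity μ with hf
  have hf0 : ∀ x, 0 ≤ f x := fun x => lebDensity_nonneg x
  have hgm : AEStronglyMeasurable g volume := hg.locallyIntegrable_grad.aestronglyMeasurable
  have hfm : Measurable f := measurable_lebDensity
  set u := fun x => f x * ‖(f x)⁻¹ • g x + x‖ ^ 2 with hu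
  have hui : Integrable u := by
    refine ⟨?_, ?_⟩
    · have : AEStronglyMeasurable (fun x => (f x)⁻¹ • g x + x) volume :=
        (hfm.inv.aestronglyMeasurable.smul hgm).add aestronglyMeasurable_id
      exact hfm.aestronglyMeasurable.mul (this.norm.pow 2)
    · rw [hasFiniteIntegral_iff_ofReal (ae_of_all _ fun x => mul_nonneg (hf0 x) (sq_nonneg _))]
      exact hlt
  obtain ⟨χ, C, hs, hc, h0, h1, hC, hev⟩ :=
    exists_dilated_cutoff (E := EuclideanSpace ℝ (Fin d))
  -- With w = f⁻¹∇f + x, expanding |w - x|² ≥ 0 gives f|x|² + 2⟨∇f, x⟩ ≤ f|w|². Where f = 0 the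
  -- cross term vanishes because the weak gradient does.
  have hpt : ∀ n, ∀ᵐ x, f x * ‖x‖ ^ 2 * χ n x ≤ u x - 2 * (inner ℝ (g x) x * χ n x) := by
    intro n
    filter_upwards [hg.ae_eq_zero hfm hf0] with x hx
    rcases eq_or_ne (f x) 0 with hfx | hfx
    · simp [hu, hfx, hx hfx]
    · set w := (f x)⁻¹ • g x + x with hw
      have hgx : g x = f x • (w - x) := by simp [hw, smul_smul, hfx]
      have hin : inner ℝ (g x) x = f x * (inner ℝ w x - ‖x‖ ^ 2) := by
        rw [hgx, real_inner_smul_left, inner_sub_left, real_inner_self_eq_norm_sq]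
      have h2 : 0 ≤ ‖w - x‖ ^ 2 := sq_nonneg _
      rw [norm_sub_sq_real] at h2
      have key : f x * ‖x‖ ^ 2 + 2 * inner ℝ (g x) x ≤ u x := by
        rw [hin]; simp only [hu]
        nlinarith [hf0 x]
      have hux : 0 ≤ u x := mul_nonneg (hf0 x) (sq_nonneg _)
      nlinarith [mul_le_mul_of_nonneg_right key (h0 n x), mul_le_mul_of_nonneg_left (h1 n x) hux]
  have hgl : LocallyIntegrable (fun x => f x * ‖x‖ ^ 2) volume :=
    hg.locallyIntegrable_fun.mul_continuous (by fun_prop)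
  -- The second moment is not yet known to be finite, so everything is truncated; the divergence
  -- identity bounds the truncated cross term uniformly in `n`.
  have hbound : ∀ n, ∫ x, f x * ‖x‖ ^ 2 * χ n x ≤ (∫ x, u x) + 2 * (d + C) := by
    intro n
    have hgi : Integrable fun x => inner ℝ (g x) x * χ n x := by
      have hgn : LocallyIntegrable (fun x => ‖g x‖) volume := fun x => by
        obtain ⟨U, hU, hi⟩ := hg.locallyIntegrable_grad x
        exact ⟨U, hU, hi.norm⟩
      have hloc : LocallyIntegrable (fun x => inner ℝ (g x) x) volume :=
        (hgn.mul_continuous continuous_norm).mono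
          (hgm.inner aestronglyMeasurable_id) (ae_of_all _ fun x => by
            simpa [abs_mul] using norm_inner_le_norm (𝕜 := ℝ) (g x) x)
      exact hloc.integrable_mul_test (hs n).continuous (hc n)
    have hdiv := hg.integral_divergence (hs n) (hc n)
    have hηd : Continuous fun x => fderiv ℝ (χ n) x x :=
      ((hs n).continuous_fderiv (by simp)).clm_apply continuous_id
    calc ∫ x, f x * ‖x‖ ^ 2 * χ n x
        ≤ ∫ x, (u x - 2 * (inner ℝ (g x) x * χ n x)) :=
          integral_mono_ae (hgl.integrable_mul_test (hs n).continuous (hc n))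
            (hui.sub (hgi.const_mul 2)) (hpt n)
      _ = (∫ x, u x) + 2 * ∫ x, f x * (d * χ n x + fderiv ℝ (χ n) x x) := by
          rw [integral_sub hui (hgi.const_mul 2), integral_const_mul, hdiv]; ring
      _ ≤ (∫ x, u x) + 2 * ∫ x, f x * (d + C) := by
          gcongr
          · exact hg.locallyIntegrable_fun.integrable_mul_test
              ((continuous_const.mul (hs n).continuous).add hηd)
              ((hc n).mul_left.add (hasCompactSupport_fderiv_apply (hc n) fun x => x))
          · exact integrable_lebDensity.mul_const _
          · intro x
            have := hf0 x
            have h3 := (abs_le.1 (hC n x)).2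
            have h4 : (d : ℝ) * χ n x ≤ d := mul_le_of_le_one_right (Nat.cast_nonneg d) (h1 n x)
            simp only
            gcongr
      _ = (∫ x, u x) + 2 * (d + C) := by
          rw [integral_mul_const, integral_lebDensity hμ, one_mul]
  -- Fatou's lemma removes the truncation.
  rw [← lintegral_lebDensity_mul_sq hμ]
  calc ∫⁻ x, ENNReal.ofReal (f x * ‖x‖ ^ 2)
      = ∫⁻ x, Filter.liminf (fun n => ENNReal.ofReal (f x * ‖x‖ ^ 2 * χ n x)) Filter.atTop := by
        refine lintegral_congr fun x => ?_
        have : Filter.Tendsto (fun n => ENNReal.ofReal (f x * ‖x‖ ^ 2 * χ n x)) Filter.atTop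
            (nhds (ENNReal.ofReal (f x * ‖x‖ ^ 2))) := by
          refine tendsto_const_nhds.congr' ?_
          filter_upwards [hev x] with n hn
          simp [hn.1]
        exact this.liminf_eq.symm
    _ ≤ Filter.liminf (fun n => ∫⁻ x, ENNReal.ofReal (f x * ‖x‖ ^ 2 * χ n x)) Filter.atTop := by
        refine lintegral_liminf_le fun n => ?_
        have := (hs n).continuous.measurable
        fun_prop
    _ ≤ ENNReal.ofReal ((∫ x, u x) + 2 * (d + C)) := by
        refine Filter.liminf_le_of_le (by isBoundedDefault) fun b hb => ?_
        obtain ⟨n, hn⟩ := hb.exists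
        refine hn.trans ?_
        rw [← ofReal_integral_eq_lintegral_ofReal
          (hgl.integrable_mul_test (hs n).continuous (hc n))
          (ae_of_all _ fun x => mul_nonneg (mul_nonneg (hf0 x) (sq_nonneg _)) (h0 n x))]
        exact ENNReal.ofReal_le_ofReal (hbound n)
    _ < ∞ := ENNReal.ofReal_lt_top

/-- Relation between the relative and the absolute Fisher information. -/
theorem relFisherInfo_add [IsProbabilityMeasure μ] (hM : sqMoment μ < ∞) :
    relFisherInfo μ + ENNReal.ofReal (2 * d) = fisherInfo μ + sqMoment μ := by
  simp only [relFisherInfo, fisherInfo, ENNReal.iInf_add]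
  -- The identity holds for each weak gradient separately. Having 2d on the left avoids truncated
  -- subtraction, and the identity remains valid when both informations are infinite.
  refine iInf_congr fun hμ => iInf_congr fun g => iInf_congr fun hg => ?_
  set f := lebDensity μ with hf
  have hf0 : ∀ x, 0 ≤ f x := fun x => lebDensity_nonneg x
  have hgm : AEStronglyMeasurable g volume := hg.locallyIntegrable_grad.aestronglyMeasurable
  have hfm : Measurable f := measurable_lebDensity
  set u := fun x => f x * ‖(f x)⁻¹ • g x + x‖ ^ 2 with hu
  set j := fun x => f x * ‖(f x)⁻¹ • g x‖ ^ 2 with hj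
  have hu0 : ∀ x, 0 ≤ u x := fun x => mul_nonneg (hf0 x) (sq_nonneg _)
  have hj0 : ∀ x, 0 ≤ j x := fun x => mul_nonneg (hf0 x) (sq_nonneg _)
  have hmg : AEStronglyMeasurable (fun x => (f x)⁻¹ • g x) volume :=
    hfm.inv.aestronglyMeasurable.smul hgm
  have hjm : AEStronglyMeasurable j volume := hfm.aestronglyMeasurable.mul (hmg.norm.pow 2)
  have hum : AEStronglyMeasurable u volume :=
    hfm.aestronglyMeasurable.mul ((hmg.add aestronglyMeasurable_id).norm.pow 2)
  have hMi := integrable_lebDensity_mul_sq hμ hM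
  have hMe := integral_lebDensity_mul_sq hμ
  have hexp : ∀ᵐ x, u x = j x + 2 * inner ℝ (g x) x + f x * ‖x‖ ^ 2 := by
    filter_upwards [hg.ae_eq_zero hfm hf0] with x hx
    rcases eq_or_ne (f x) 0 with hfx | hfx
    · simp [hu, hj, hfx, hx hfx]
    · simp only [hu, hj]
      rw [norm_add_sq_real, real_inner_smul_left]
      field_simp
  -- As the second moment is finite, |w|² ≤ 2|w+x|² + 2|x|² shows that an infinite J forces an
  -- infinite I.
  by_cases hJ : ∫⁻ x, ENNReal.ofReal (j x) = ∞
  · have hI : ∫⁻ x, ENNReal.ofReal (u x) = ∞ := by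
      by_contra hne
      have hui : Integrable u := ⟨hum, by
        rw [hasFiniteIntegral_iff_ofReal (ae_of_all _ hu0)]; exact lt_top_iff_ne_top.2 hne⟩
      have hji : Integrable j := by
        refine ((hui.const_mul 2).add (hMi.const_mul 2)).mono' hjm (ae_of_all _ fun x => ?_)
        rw [Real.norm_of_nonneg (hj0 x)]
        simp only [hu, hj, Pi.add_apply]
        set w := (f x)⁻¹ • g x
        have h1 : ‖w‖ ≤ ‖w + x‖ + ‖x‖ := by
          simpa using norm_sub_le (w + x) x
        have h2 : ‖w‖ ^ 2 ≤ 2 * ‖w + x‖ ^ 2 + 2 * ‖x‖ ^ 2 := by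
          nlinarith [norm_nonneg w, sq_nonneg (‖w + x‖ - ‖x‖), norm_nonneg (w + x), norm_nonneg x]
        nlinarith [mul_le_mul_of_nonneg_left h2 (hf0 x)]
      have := hji.2
      rw [hasFiniteIntegral_iff_ofReal (ae_of_all _ hj0), hJ] at this
      exact lt_irrefl _ this
    rw [hI, hJ]; simp
  · have hji : Integrable j := ⟨hjm, by
      rw [hasFiniteIntegral_iff_ofReal (ae_of_all _ hj0)]; exact lt_top_iff_ne_top.2 hJ⟩
    have hgi : Integrable fun x => inner ℝ (g x) x := by
      refine (hji.add hMi).mono' (hgm.inner aestronglyMeasurable_id) ?_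
      filter_upwards [hg.ae_eq_zero hfm hf0] with x hx
      rcases eq_or_ne (f x) 0 with hfx | hfx
      · simp [hj, hfx, hx hfx, ← hf]
      · have hin : inner ℝ (g x) x = f x * inner ℝ ((f x)⁻¹ • g x) x := by
          rw [real_inner_smul_left]; field_simp
        rw [hin]
        simp only [hj, Pi.add_apply]
        set w := (f x)⁻¹ • g x
        rw [norm_mul, Real.norm_of_nonneg (hf0 x), ← mul_add]
        refine mul_le_mul_of_nonneg_left ((norm_inner_le_norm w x).trans ?_) (hf0 x)
        nlinarith [sq_nonneg (‖w‖ - ‖x‖), sq_nonneg ‖w‖, sq_nonneg ‖x‖]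
    have hui : Integrable u :=
      ((hji.add (hgi.const_mul 2)).add hMi).congr (hexp.mono fun x hx => hx.symm)
    have hint : (∫ x, u x) + 2 * d = (∫ x, j x) + (sqMoment μ).toReal := by
      have hjg : Integrable fun x => j x + 2 * inner ℝ (g x) x := hji.add (hgi.const_mul 2)
      rw [integral_congr_ae hexp, integral_add hjg hMi,
        integral_add hji (hgi.const_mul 2), integral_const_mul,
        hg.integral_inner_id integrable_lebDensity hgi, integral_lebDensity hμ, hMe]
      ring
    rw [← ofReal_integral_eq_lintegral_ofReal hui (ae_of_all _ hu0),
      ← ofReal_integral_eq_lintegral_ofReal hji (ae_of_all _ hj0),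
      ← ENNReal.ofReal_add (integral_nonneg hu0) (by positivity), hint,
      ENNReal.ofReal_add (integral_nonneg hj0) ENNReal.toReal_nonneg, ENNReal.ofReal_toReal hM.ne]

end Fisher

/-! ### The standard Gaussian measure. -/

section Gaussian

variable (d : ℕ)

/-- The density of the standard Gaussian measure. -/
noncomputable def gaussDensity (x : EuclideanSpace ℝ (Fin d)) : ℝ :=
  (2 * Real.pi) ^ (-(d : ℝ) / 2) * Real.exp (-‖x‖ ^ 2 / 2)

theorem gaussDensity_pos (x : EuclideanSpace ℝ (Fin d)) : 0 < gaussDensity d x := by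
  unfold gaussDensity; positivity

theorem measurable_gaussDensity : Measurable (gaussDensity d) := by
  unfold gaussDensity; fun_prop

theorem log_gaussDensity (x : EuclideanSpace ℝ (Fin d)) :
    Real.log (gaussDensity d x) = -(d / 2 * Real.log (2 * Real.pi) + ‖x‖ ^ 2 / 2) := by
  rw [gaussDensity, Real.log_mul (by positivity) (by positivity), Real.log_exp,
    Real.log_rpow (by positivity)]
  ring

theorem integrable_exp_neg_mul_norm_sq {b : ℝ} (hb : 0 < b) :
    Integrable fun x : EuclideanSpace ℝ (Fin d) => Real.exp (-b * ‖x‖ ^ 2) := by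
  have h := GaussianFourier.integral_rexp_neg_mul_sq_norm (V := EuclideanSpace ℝ (Fin d)) hb
  -- The integral of a non-integrable function is 0 by convention, whereas the Gaussian integral is
  -- positive.
  by_contra hn
  rw [integral_undef hn] at h
  have : 0 < (Real.pi / b) ^ (Module.finrank ℝ (EuclideanSpace ℝ (Fin d)) / 2 : ℝ) := by positivity
  linarith

theorem integrable_gaussDensity : Integrable (gaussDensity d) := by
  have := (integrable_exp_neg_mul_norm_sq d (b := 1 / 2) (by norm_num)).const_mul
    ((2 * Real.pi) ^ (-(d : ℝ) / 2))
  refine this.congr (ae_of_all _ fun x => ?_)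
  simp only [gaussDensity]
  congr 2; ring

theorem integral_gaussDensity : ∫ x, gaussDensity d x = 1 := by
  have h := GaussianFourier.integral_rexp_neg_mul_sq_norm (V := EuclideanSpace ℝ (Fin d))
    (b := 1 / 2) (by norm_num)
  have e : ∀ x : EuclideanSpace ℝ (Fin d), -‖x‖ ^ 2 / 2 = -(1 / 2) * ‖x‖ ^ 2 := fun x => by ring
  simp only [gaussDensity, integral_const_mul, e]
  rw [h, finrank_euclideanSpace_fin, div_div_eq_mul_div, div_one, mul_comm Real.pi 2,
    ← Real.rpow_add (by positivity)]
  ring_nf; simp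

theorem stdGauss_eq : stdGauss d = volume.withDensity fun x => ENNReal.ofReal (gaussDensity d x) :=
  rfl

instance isProbabilityMeasure_stdGauss : IsProbabilityMeasure (stdGauss d) := ⟨by
  rw [stdGauss_eq, withDensity_apply _ MeasurableSet.univ, Measure.restrict_univ,
    ← ofReal_integral_eq_lintegral_ofReal (integrable_gaussDensity d)
      (ae_of_all _ fun x => (gaussDensity_pos d x).le), integral_gaussDensity, ENNReal.ofReal_one]⟩

theorem sqMoment_stdGauss_lt_top : sqMoment (stdGauss d) < ∞ := by
  have hm := (measurable_gaussDensity d).ennreal_ofReal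
  rw [sqMoment, stdGauss_eq, lintegral_withDensity_eq_lintegral_mul _ hm (by fun_prop)]
  have hi : Integrable fun x : EuclideanSpace ℝ (Fin d) => gaussDensity d x * ‖x‖ ^ 2 := by
    refine ((integrable_exp_neg_mul_norm_sq d (b := 1 / 4) (by norm_num)).const_mul
      ((2 * Real.pi) ^ (-(d : ℝ) / 2) * 4)).mono'
      ((measurable_gaussDensity d).mul (by fun_prop)).aestronglyMeasurable (ae_of_all _ fun x => ?_)
    rw [Real.norm_of_nonneg (mul_nonneg (gaussDensity_pos d x).le (sq_nonneg _)), gaussDensity,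
      mul_assoc, mul_assoc]
    have h1 : ‖x‖ ^ 2 ≤ 4 * Real.exp (‖x‖ ^ 2 / 4) := by
      have := Real.add_one_le_exp (‖x‖ ^ 2 / 4)
      linarith
    have h2 : Real.exp (-‖x‖ ^ 2 / 2) * Real.exp (‖x‖ ^ 2 / 4) = Real.exp (-(1 / 4) * ‖x‖ ^ 2) := by
      rw [← Real.exp_add]; congr 1; ring
    refine mul_le_mul_of_nonneg_left ?_ (by positivity)
    calc Real.exp (-‖x‖ ^ 2 / 2) * ‖x‖ ^ 2
        ≤ Real.exp (-‖x‖ ^ 2 / 2) * (4 * Real.exp (‖x‖ ^ 2 / 4)) := by gcongr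
      _ = 4 * Real.exp (-(1 / 4) * ‖x‖ ^ 2) := by rw [← h2]; ring
  have := hi.2
  rw [hasFiniteIntegral_iff_ofReal (ae_of_all _ fun x =>
    mul_nonneg (gaussDensity_pos d x).le (sq_nonneg _))] at this
  refine lt_of_le_of_lt (le_of_eq (lintegral_congr fun x => ?_)) this
  rw [Pi.mul_apply, ← ENNReal.ofReal_mul (gaussDensity_pos d x).le]

theorem relEntropy_stdGauss : relEntropy (stdGauss d) = 0 :=
  InformationTheory.klDiv_self _

end Gaussian

/-! ### Differential entropy and relative entropy. -/

section Entropy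

variable {d : ℕ} {μ : Measure (EuclideanSpace ℝ (Fin d))}

theorem integrable_of_lintegral_ofReal {X : Type*} [MeasurableSpace X] {ν : Measure X} {f : X → ℝ}
    (hf : AEStronglyMeasurable f ν) (h1 : ∫⁻ x, ENNReal.ofReal (f x) ∂ν ≠ ∞)
    (h2 : ∫⁻ x, ENNReal.ofReal (-f x) ∂ν ≠ ∞) : Integrable f ν := by
  have hm : AEMeasurable (fun x => ENNReal.ofReal (f x)) ν := hf.aemeasurable.ennreal_ofReal
  refine ⟨hf, ?_⟩
  have : ∀ x, ‖f x‖ₑ = ENNReal.ofReal (f x) + ENNReal.ofReal (-f x) := fun x => by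
    rw [← ofReal_norm, Real.norm_eq_abs]
    rcases le_total 0 (f x) with h | h
    · rw [abs_of_nonneg h, ENNReal.ofReal_of_nonpos (neg_nonpos.2 h), add_zero]
    · rw [abs_of_nonpos h, ENNReal.ofReal_of_nonpos h, zero_add]
  simp only [HasFiniteIntegral, this]
  rw [lintegral_add_left' hm]
  exact ENNReal.add_lt_top.2 ⟨lt_top_iff_ne_top.2 h1, lt_top_iff_ne_top.2 h2⟩

theorem MeasureTheory.Integrable.lintegral_ofReal_ne_top {X : Type*} [MeasurableSpace X] {ν : Measure X}
    {f : X → ℝ} (hf : Integrable f ν) : ∫⁻ x, ENNReal.ofReal (f x) ∂ν ≠ ∞ :=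
  ((lintegral_mono fun x => Real.ofReal_le_enorm (f x)).trans_lt hf.2).ne

theorem measurable_lebDensity_mul_log :
    Measurable fun x => lebDensity μ x * Real.log (lebDensity μ x) :=
  measurable_lebDensity.mul measurable_lebDensity.log

/-- In `EReal`, subtracting ⊤ always gives ⊥, and ⊤ minus a real is ⊤. A real value therefore forces
both parts of the integral to be finite. -/
theorem diffEntropy_eq_coe_iff {r : ℝ} : diffEntropy μ = r ↔ μ ≪ volume ∧
    Integrable (fun x => lebDensity μ x * Real.log (lebDensity μ x)) ∧
    r = - ∫ x, lebDensity μ x * Real.log (lebDensity μ x) := by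
  set ψ := fun x => lebDensity μ x * Real.log (lebDensity μ x) with hψ
  have hψm : Measurable ψ := measurable_lebDensity_mul_log
  by_cases hμ : μ ≪ volume
  · have hval : diffEntropy μ = ((∫⁻ x, ENNReal.ofReal (-ψ x) : ℝ≥0∞) : EReal)
        - ((∫⁻ x, ENNReal.ofReal (ψ x) : ℝ≥0∞) : EReal) := by
      rw [diffEntropy, if_pos hμ]
    have hfin : Integrable ψ → diffEntropy μ = ((- ∫ x, ψ x : ℝ) : EReal) := by
      intro hi
      rw [hval, integral_eq_lintegral_pos_part_sub_lintegral_neg_part hi,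
        ← EReal.coe_ennreal_toReal hi.lintegral_ofReal_ne_top,
        ← EReal.coe_ennreal_toReal (show ∫⁻ x, ENNReal.ofReal (-ψ x) ≠ ∞ from
          hi.neg.lintegral_ofReal_ne_top), neg_sub, EReal.coe_sub]
    constructor
    · intro h
      have hi : Integrable ψ := by
        refine integrable_of_lintegral_ofReal hψm.aestronglyMeasurable ?_ ?_
        · intro htop
          rw [hval, htop, EReal.coe_ennreal_top, EReal.sub_top] at h
          exact EReal.bot_ne_coe r h
        · intro htop
          rw [hval, htop, EReal.coe_ennreal_top] at h
          by_cases hB : ∫⁻ x, ENNReal.ofReal (ψ x) = ∞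
          · rw [hB, EReal.coe_ennreal_top, EReal.sub_top] at h
            exact EReal.bot_ne_coe r h
          · rw [← EReal.coe_ennreal_toReal hB, EReal.top_sub_coe] at h
            exact EReal.top_ne_coe r h
      refine ⟨hμ, hi, ?_⟩
      rw [hfin hi] at h
      exact (EReal.coe_injective h).symm
    · rintro ⟨-, hi, rfl⟩
      exact hfin hi
  · simp only [hμ, false_and, iff_false]
    rw [diffEntropy, if_neg hμ]
    exact EReal.bot_ne_coe r

/-- The majorant of `-f log f` obtained by comparing `f` with the Gaussian density. -/
noncomputable def entropyBound (μ : Measure (EuclideanSpace ℝ (Fin d)))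
    (x : EuclideanSpace ℝ (Fin d)) : ℝ :=
  lebDensity μ x * (d / 2 * Real.log (2 * Real.pi)) + lebDensity μ x * ‖x‖ ^ 2 / 2
    + gaussDensity d x - lebDensity μ x

/-- With φ the Gaussian density, φ klFun(f/φ) = f log(f/φ) + φ - f. The terms φ - f make the
integrand nonnegative pointwise and integrate to zero for a probability density, so D can be
computed without cancellation of infinities. -/
theorem gaussDensity_mul_klFun (x : EuclideanSpace ℝ (Fin d)) :
    gaussDensity d x * InformationTheory.klFun ((gaussDensity d x)⁻¹ * lebDensity μ x)
      = lebDensity μ x * Real.log (lebDensity μ x) + entropyBound μ x := by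
  have hp := gaussDensity_pos d x
  rw [InformationTheory.klFun_apply, entropyBound]
  rcases eq_or_ne (lebDensity μ x) 0 with h | h
  · simp [h]
  · rw [Real.log_mul (inv_ne_zero hp.ne') h, Real.log_inv, log_gaussDensity]
    field_simp
    ring

theorem mul_log_add_entropyBound_nonneg (x : EuclideanSpace ℝ (Fin d)) :
    0 ≤ lebDensity μ x * Real.log (lebDensity μ x) + entropyBound μ x := by
  rw [← gaussDensity_mul_klFun]
  have hp := gaussDensity_pos d x
  exact mul_nonneg hp.le
    (InformationTheory.klFun_nonneg (mul_nonneg (inv_nonneg.2 hp.le) (lebDensity_nonneg x)))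

theorem integrable_entropyBound [IsProbabilityMeasure μ] (hμ : μ ≪ volume)
    (hM : sqMoment μ < ∞) : Integrable (entropyBound μ) :=
  (((integrable_lebDensity.mul_const _).add
    ((integrable_lebDensity_mul_sq hμ hM).div_const 2)).add (integrable_gaussDensity d)).sub
    integrable_lebDensity

theorem integral_entropyBound [IsProbabilityMeasure μ] (hμ : μ ≪ volume)
    (hM : sqMoment μ < ∞) : ∫ x, entropyBound μ x
      = d / 2 * Real.log (2 * Real.pi) + (sqMoment μ).toReal / 2 := by
  have i1 : Integrable fun x => lebDensity μ x * (d / 2 * Real.log (2 * Real.pi)) :=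
    integrable_lebDensity.mul_const _
  have i2 : Integrable fun x => lebDensity μ x * ‖x‖ ^ 2 / 2 :=
    (integrable_lebDensity_mul_sq hμ hM).div_const 2
  have i12 : Integrable fun x => lebDensity μ x * (d / 2 * Real.log (2 * Real.pi))
    + lebDensity μ x * ‖x‖ ^ 2 / 2 := i1.add i2
  have i123 : Integrable fun x => lebDensity μ x * (d / 2 * Real.log (2 * Real.pi))
    + lebDensity μ x * ‖x‖ ^ 2 / 2 + gaussDensity d x := i12.add (integrable_gaussDensity d)
  simp only [entropyBound]
  rw [integral_sub i123 integrable_lebDensity, integral_add i12 (integrable_gaussDensity d),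
    integral_add i1 i2, integral_mul_const, integral_div, integral_lebDensity hμ,
    integral_gaussDensity, integral_lebDensity_mul_sq hμ]
  ring

theorem absolutelyContinuous_stdGauss_iff : μ ≪ stdGauss d ↔ μ ≪ volume := by
  rw [stdGauss_eq]
  refine ⟨fun h => h.trans (withDensity_absolutelyContinuous _ _), fun h => h.trans ?_⟩
  refine withDensity_absolutelyContinuous' (measurable_gaussDensity d).ennreal_ofReal.aemeasurable
    (ae_of_all _ fun x => ?_)
  simpa using gaussDensity_pos d x

theorem relEntropy_eq_lintegral [IsProbabilityMeasure μ] (hμ : μ ≪ volume) :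
    relEntropy μ = ∫⁻ x, ENNReal.ofReal
      (lebDensity μ x * Real.log (lebDensity μ x) + entropyBound μ x) := by
  have hm := (measurable_gaussDensity d).ennreal_ofReal
  rw [relEntropy, InformationTheory.klDiv_eq_lintegral_klFun_of_ac
    (absolutelyContinuous_stdGauss_iff.2 hμ), stdGauss_eq]
  rw [lintegral_withDensity_eq_lintegral_mul _ hm
    (by have := InformationTheory.measurable_klFun; fun_prop)]
  refine lintegral_congr_ae ?_
  filter_upwards [Measure.rnDeriv_withDensity_right μ volume hm.aemeasurable
    (ae_of_all _ fun x => by simpa using gaussDensity_pos d x)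
    (ae_of_all _ fun x => ENNReal.ofReal_ne_top)] with x hx
  have hp := gaussDensity_pos d x
  rw [Pi.mul_apply, hx, ← ENNReal.ofReal_mul hp.le, ENNReal.toReal_mul, ENNReal.toReal_inv,
    ENNReal.toReal_ofReal hp.le, ← gaussDensity_mul_klFun]
  rfl

/-- For a law with finite second moment, the relative entropy is expressed through the
differential entropy. -/
theorem entropy_dichotomy [IsProbabilityMeasure μ] (hM : sqMoment μ < ∞) :
    (diffEntropy μ = ⊥ ∧ relEntropy μ = ∞) ∨
    ∃ r : ℝ, diffEntropy μ = r ∧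
      0 ≤ -r + d / 2 * Real.log (2 * Real.pi) + (sqMoment μ).toReal / 2 ∧
      relEntropy μ = ENNReal.ofReal
        (-r + d / 2 * Real.log (2 * Real.pi) + (sqMoment μ).toReal / 2) := by
  by_cases hμ : μ ≪ volume
  · have hi := integrable_entropyBound hμ hM
    have hmeas := measurable_lebDensity_mul_log (μ := μ)
    have hnn := mul_log_add_entropyBound_nonneg (μ := μ)
    by_cases hψ : Integrable fun x => lebDensity μ x * Real.log (lebDensity μ x)
    · right
      have hint : ∫ x, (lebDensity μ x * Real.log (lebDensity μ x) + entropyBound μ x)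
          = - (- ∫ x, lebDensity μ x * Real.log (lebDensity μ x))
            + d / 2 * Real.log (2 * Real.pi) + (sqMoment μ).toReal / 2 := by
        rw [integral_add hψ hi, integral_entropyBound hμ hM]; ring
      refine ⟨_, diffEntropy_eq_coe_iff.2 ⟨hμ, hψ, rfl⟩, ?_, ?_⟩
      · rw [← hint]; exact integral_nonneg hnn
      · rw [relEntropy_eq_lintegral hμ, ← hint]
        exact (ofReal_integral_eq_lintegral_ofReal (hψ.add hi) (ae_of_all _ hnn)).symm
    · left
      -- The Gaussian majorant controls the positive part of -f log f. Non-integrability can then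
      -- only come from f log f being too large, which makes h = -∞ and D = ∞ together.
      have hneg : ∫⁻ x, ENNReal.ofReal (-(lebDensity μ x * Real.log (lebDensity μ x))) ≠ ∞ := by
        refine ((lintegral_mono fun x => ENNReal.ofReal_le_ofReal ?_).trans_lt
          (lt_top_iff_ne_top.2 hi.lintegral_ofReal_ne_top)).ne
        linarith [hnn x]
      have hpos : ∫⁻ x, ENNReal.ofReal (lebDensity μ x * Real.log (lebDensity μ x)) = ∞ := by
        by_contra h
        exact hψ (integrable_of_lintegral_ofReal hmeas.aestronglyMeasurable h hneg)
      constructor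
      · rw [diffEntropy, if_pos hμ, hpos, EReal.coe_ennreal_top, EReal.sub_top]
      · rw [relEntropy_eq_lintegral hμ]
        by_contra h
        have hsum : Integrable fun x =>
            lebDensity μ x * Real.log (lebDensity μ x) + entropyBound μ x :=
          integrable_of_lintegral_ofReal
            (hmeas.aestronglyMeasurable.add hi.aestronglyMeasurable) h (by
              have : ∀ x, ENNReal.ofReal
                  (-(lebDensity μ x * Real.log (lebDensity μ x) + entropyBound μ x)) = 0 :=
                fun x => ENNReal.ofReal_of_nonpos (neg_nonpos.2 (hnn x))
              simp only [this, lintegral_zero]; exact ENNReal.zero_ne_top)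
        exact hψ ((hsum.sub hi).congr (ae_of_all _ fun x => by simp))
  · left
    refine ⟨by rw [diffEntropy, if_neg hμ], ?_⟩
    rw [relEntropy, InformationTheory.klDiv_of_not_ac]
    rwa [absolutelyContinuous_stdGauss_iff]

theorem diffEntropy_map_affine [IsProbabilityMeasure μ] {r : ℝ} (h : diffEntropy μ = r) {a : ℝ}
    (ha : 0 < a) (b : EuclideanSpace ℝ (Fin d)) :
    diffEntropy (μ.map fun x => a • x + b) = ((r + d * Real.log a : ℝ) : EReal) := by
  obtain ⟨hμ, hi, hr⟩ := diffEntropy_eq_coe_iff.1 h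
  have hdens := lebDensity_map_affine hμ ha b
  set f := lebDensity μ with hf
  have hc : 0 < (a ^ d)⁻¹ := by positivity
  set φ := fun x => (a ^ d)⁻¹ * (f x * Real.log (f x) - d * Real.log a * f x) with hφ
  have hφi : Integrable φ := (hi.sub (integrable_lebDensity.const_mul _)).const_mul _
  have he : (fun y => lebDensity (μ.map fun x => a • x + b) y *
      Real.log (lebDensity (μ.map fun x => a • x + b) y)) =ᵐ[volume]
      fun y => φ (a⁻¹ • (y - b)) := by
    filter_upwards [hdens] with y hy
    rw [hy]
    simp only [hφ]
    rcases eq_or_ne (f (a⁻¹ • (y - b))) 0 with h0 | h0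
    · simp [h0]
    · rw [Real.log_mul hc.ne' h0, Real.log_inv, Real.log_pow]; ring
  refine diffEntropy_eq_coe_iff.2 ⟨map_affine_absolutelyContinuous hμ ha b,
    (integrable_comp_affine ha b hφi).congr he.symm, ?_⟩
  have i2 : Integrable fun x => d * Real.log a * f x := integrable_lebDensity.const_mul _
  rw [integral_congr_ae he, integral_comp_affine ha b, hφ, integral_const_mul,
    integral_sub hi i2, integral_const_mul, integral_lebDensity hμ, hr, smul_eq_mul,
    ← mul_assoc, mul_inv_cancel₀ (by positivity)]
  ring

end Entropy

/-! ### Convolution and monotonicity of entropy. -/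

section Convolution

variable {d : ℕ} {μ ν : Measure (EuclideanSpace ℝ (Fin d))}

theorem integrable_prod_sub [IsFiniteMeasure μ] {F : EuclideanSpace ℝ (Fin d) → ℝ}
    (hF : Integrable F) :
    Integrable (fun p : EuclideanSpace ℝ (Fin d) × EuclideanSpace ℝ (Fin d) => F (p.2 - p.1))
      (μ.prod volume) := by
  have h : MeasurePreserving
      (fun p : EuclideanSpace ℝ (Fin d) × EuclideanSpace ℝ (Fin d) => (p.1, p.2 - p.1))
      (μ.prod volume) (μ.prod volume) :=
    (MeasurePreserving.id _).skew_product (g := fun s x => x - s) (by fun_prop)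
      (ae_of_all _ fun s => (measurePreserving_sub_right volume s).map_eq)
  have h2 : Integrable (fun p : EuclideanSpace ℝ (Fin d) × EuclideanSpace ℝ (Fin d) => F p.2)
      (μ.prod volume) := hF.comp_snd _
  exact (h.integrable_comp h2.aestronglyMeasurable).2 h2

theorem conv_eq_withDensity [IsFiniteMeasure μ] [IsFiniteMeasure ν] (hν : ν ≪ volume) :
    μ.conv ν = volume.withDensity fun z => ∫⁻ x, ν.rnDeriv volume (z - x) ∂μ := by
  have hk := Measure.measurable_rnDeriv ν volume
  ext s hs
  rw [← lintegral_indicator_one hs, Measure.lintegral_conv (measurable_one.indicator hs),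
    withDensity_apply _ hs, ← lintegral_indicator hs]
  have e1 : ∀ x, ∫⁻ y, s.indicator 1 (x + y) ∂ν
      = ∫⁻ z, s.indicator 1 z * ν.rnDeriv volume (z - x) := by
    intro x
    have hm : Measurable fun y => s.indicator (1 : EuclideanSpace ℝ (Fin d) → ℝ≥0∞) (x + y) :=
      (measurable_one.indicator hs).comp (by fun_prop)
    rw [← lintegral_rnDeriv_mul hν hm.aemeasurable,
      ← lintegral_sub_right_eq_self
        (fun y => ν.rnDeriv volume y * s.indicator (1 : EuclideanSpace ℝ (Fin d) → ℝ≥0∞) (x + y)) x]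
    refine lintegral_congr fun z => ?_
    rw [add_sub_cancel, mul_comm]
  simp only [e1]
  have hj : Measurable fun p : EuclideanSpace ℝ (Fin d) × EuclideanSpace ℝ (Fin d) =>
      s.indicator (1 : EuclideanSpace ℝ (Fin d) → ℝ≥0∞) p.2 * ν.rnDeriv volume (p.2 - p.1) :=
    ((measurable_one.indicator hs).comp measurable_snd).mul (hk.comp (by fun_prop))
  rw [lintegral_lintegral_swap hj.aemeasurable]
  refine lintegral_congr fun z => ?_
  by_cases hz : z ∈ s <;> simp [hz]

theorem lebDensity_conv [IsFiniteMeasure μ] [IsFiniteMeasure ν] (hν : ν ≪ volume) :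
    lebDensity (μ.conv ν) =ᵐ[volume] fun z => ∫ x, lebDensity ν (z - x) ∂μ := by
  have hk := Measure.measurable_rnDeriv ν volume
  have hm : Measurable fun z => ∫⁻ x, ν.rnDeriv volume (z - x) ∂μ :=
    Measurable.lintegral_prod_right'
      (f := fun p : EuclideanSpace ℝ (Fin d) × EuclideanSpace ℝ (Fin d) =>
        ν.rnDeriv volume (p.1 - p.2)) (hk.comp (by fun_prop))
  rw [conv_eq_withDensity hν]
  have hfin : ∀ᵐ p ∂(μ.prod (volume : Measure (EuclideanSpace ℝ (Fin d)))),
      ν.rnDeriv volume (p.2 - p.1) < ∞ := by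
    have h : MeasurePreserving
        (fun p : EuclideanSpace ℝ (Fin d) × EuclideanSpace ℝ (Fin d) => (p.1, p.2 - p.1))
        (μ.prod volume) (μ.prod volume) :=
      (MeasurePreserving.id _).skew_product (g := fun s x => x - s) (by fun_prop)
        (ae_of_all _ fun s => (measurePreserving_sub_right volume s).map_eq)
    exact h.quasiMeasurePreserving.ae
      (Measure.quasiMeasurePreserving_snd.ae (ν.rnDeriv_lt_top volume))
  have hswap : ∀ᵐ p ∂((volume : Measure (EuclideanSpace ℝ (Fin d))).prod μ),
      ν.rnDeriv volume (p.1 - p.2) < ∞ :=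
    (Measure.measurePreserving_swap (μ := (volume : Measure (EuclideanSpace ℝ (Fin d))))
      (ν := μ)).quasiMeasurePreserving.ae hfin
  filter_upwards [lebDensity_withDensity hm, Measure.ae_ae_of_ae_prod hswap] with z hz hz2
  rw [hz]
  simp only [lebDensity]
  exact (integral_toReal (by fun_prop) hz2).symm

/-- Adding an independent summand does not decrease the differential entropy. -/
theorem diffEntropy_le_conv [IsProbabilityMeasure μ] [IsProbabilityMeasure ν] {r : ℝ}
    (h : diffEntropy ν = r) (hM : sqMoment (μ.conv ν) < ∞) :
    ∃ r' : ℝ, r ≤ r' ∧ diffEntropy (μ.conv ν) = r' := by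
  obtain ⟨hν, hψ, hr⟩ := diffEntropy_eq_coe_iff.1 h
  have hac : μ.conv ν ≪ volume := by
    rw [conv_eq_withDensity hν]; exact withDensity_absolutelyContinuous _ _
  set q := lebDensity (μ.conv ν) with hq
  set f := lebDensity ν with hf
  have hf1 := integrable_prod_sub (μ := μ) (integrable_lebDensity (μ := ν))
  have hψ1 := integrable_prod_sub (μ := μ) hψ
  have hΨ : Integrable fun z => ∫ x, f (z - x) * Real.log (f (z - x)) ∂μ :=
    hψ1.integral_prod_right
  -- Jensen's inequality for t log t: the density of the convolution at `z` is an average of values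
  -- of `f` against the probability measure `μ`, which itself need not have a density.
  have hle : ∀ᵐ z, q z * Real.log (q z) ≤ ∫ x, f (z - x) * Real.log (f (z - x)) ∂μ := by
    filter_upwards [lebDensity_conv (μ := μ) hν, hf1.prod_left_ae, hψ1.prod_left_ae]
      with z hz h1 h2
    rw [hq, hz]
    exact Real.convexOn_mul_log.map_integral_le Real.continuous_mul_log.continuousOn
      isClosed_Ici (ae_of_all _ fun x => lebDensity_nonneg (z - x)) h1 h2
  -- Jensen bounds q log q from above; the Gaussian comparison, available since the convolution has
  -- a finite second moment, bounds it from below.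
  have hqi : Integrable fun z => q z * Real.log (q z) := by
    refine (hΨ.abs.add (integrable_entropyBound hac hM).abs).mono'
      measurable_lebDensity_mul_log.aestronglyMeasurable ?_
    filter_upwards [hle] with z hz
    have h1 := mul_log_add_entropyBound_nonneg (μ := μ.conv ν) z
    simp only [Pi.add_apply]
    rw [Real.norm_eq_abs, abs_le]
    constructor
    · linarith [le_abs_self (entropyBound (μ.conv ν) z),
        abs_nonneg (∫ x, f (z - x) * Real.log (f (z - x)) ∂μ)]
    · linarith [abs_nonneg (entropyBound (μ.conv ν) z),
        le_abs_self (∫ x, f (z - x) * Real.log (f (z - x)) ∂μ)]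
  refine ⟨_, ?_, diffEntropy_eq_coe_iff.2 ⟨hac, hqi, rfl⟩⟩
  rw [hr, neg_le_neg_iff]
  calc ∫ z, q z * Real.log (q z) ≤ ∫ z, ∫ x, f (z - x) * Real.log (f (z - x)) ∂μ :=
        integral_mono_ae hqi hΨ hle
    _ = ∫ x, (∫ z, f (z - x) * Real.log (f (z - x))) ∂μ := (integral_integral_swap hψ1).symm
    _ = ∫ x, f x * Real.log (f x) := by
        have : ∀ x, ∫ z, f (z - x) * Real.log (f (z - x)) = ∫ z, f z * Real.log (f z) := fun x =>
          integral_sub_right_eq_self (fun z => f z * Real.log (f z)) x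
        simp [this]

end Convolution

/-! ### Real-valued forms of entropy power, Stam defect, D and I. -/

section EntropyPower

variable {d : ℕ} {μ : Measure (EuclideanSpace ℝ (Fin d))}

/-- The entropy power of a law with differential entropy `r`, as a real number. -/
noncomputable def realEntropyPower (d : ℕ) (r : ℝ) : ℝ :=
  Real.exp (2 / d * r) / (2 * Real.pi * Real.exp 1)

theorem realEntropyPower_pos (r : ℝ) : 0 < realEntropyPower d r := by
  unfold realEntropyPower; positivity

theorem log_realEntropyPower (r : ℝ) :
    Real.log (realEntropyPower d r) = 2 / d * r - Real.log (2 * Real.pi) - 1 := by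
  rw [realEntropyPower, Real.log_div (by positivity) (by positivity),
    Real.log_mul (by positivity) (by positivity), Real.log_exp, Real.log_exp]
  ring

theorem realEntropyPower_mono {r s : ℝ} (h : r ≤ s) :
    realEntropyPower d r ≤ realEntropyPower d s := by
  unfold realEntropyPower; gcongr

theorem entropyPower_eq_zero (h : diffEntropy μ = ⊥) (hd : 0 < d) : entropyPower μ = 0 := by
  have : (0 : ℝ) < 2 / d := by positivity
  rw [entropyPower, h, EReal.coe_mul_bot_of_pos this, EReal.exp_bot, mul_zero]

theorem entropyPower_eq_ofReal {r : ℝ} (h : diffEntropy μ = r) :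
    entropyPower μ = ENNReal.ofReal (realEntropyPower d r) := by
  rw [entropyPower, h, ← EReal.coe_mul, EReal.exp_coe, ← ENNReal.ofReal_mul (by positivity),
    realEntropyPower]
  congr 1; ring

theorem stamDefect_eq_ofReal (hd : 0 < d) {r : ℝ} (h : diffEntropy μ = r) (hJ : fisherInfo μ < ∞) :
    stamDefect μ = ENNReal.ofReal (realEntropyPower d r * (fisherInfo μ).toReal / d) := by
  rw [stamDefect, if_neg hJ.ne, entropyPower_eq_ofReal h,
    ENNReal.ofReal_div_of_pos (by positivity), ENNReal.ofReal_mul (realEntropyPower_pos r).le,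
    ENNReal.ofReal_toReal hJ.ne, ENNReal.ofReal_natCast]

theorem exists_diffEntropy_eq_of_relEntropy_ne_top [IsProbabilityMeasure μ] (hM : sqMoment μ < ∞)
    (h : relEntropy μ ≠ ∞) : ∃ r : ℝ, diffEntropy μ = r := by
  rcases entropy_dichotomy hM with ⟨-, h'⟩ | ⟨r, hr, -⟩
  exacts [absurd h' h, ⟨r, hr⟩]

theorem relEntropy_eq_ofReal [IsProbabilityMeasure μ] (hM : sqMoment μ < ∞) {r : ℝ}
    (h : diffEntropy μ = r) : 0 ≤ -r + d / 2 * Real.log (2 * Real.pi) + (sqMoment μ).toReal / 2 ∧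
      relEntropy μ = ENNReal.ofReal
        (-r + d / 2 * Real.log (2 * Real.pi) + (sqMoment μ).toReal / 2) := by
  rcases entropy_dichotomy hM with ⟨h', -⟩ | ⟨s, hs, h1, h2⟩
  · rw [h] at h'; exact absurd h'.symm (EReal.bot_ne_coe r)
  · rw [h] at hs
    obtain rfl := EReal.coe_injective hs
    exact ⟨h1, h2⟩

theorem relFisherInfo_lt_top [IsProbabilityMeasure μ] (hM : sqMoment μ < ∞)
    (hJ : fisherInfo μ < ∞) : relFisherInfo μ < ∞ :=
  lt_of_le_of_lt (le_self_add.trans (relFisherInfo_add hM).le) (ENNReal.add_lt_top.2 ⟨hJ, hM⟩)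

theorem fisherInfo_lt_top [IsProbabilityMeasure μ] (hM : sqMoment μ < ∞)
    (hI : relFisherInfo μ < ∞) : fisherInfo μ < ∞ :=
  lt_of_le_of_lt (le_self_add.trans (relFisherInfo_add hM).ge)
    (ENNReal.add_lt_top.2 ⟨hI, ENNReal.ofReal_lt_top⟩)

theorem toReal_relFisherInfo [IsProbabilityMeasure μ] (hM : sqMoment μ < ∞)
    (hJ : fisherInfo μ < ∞) : (relFisherInfo μ).toReal
      = (fisherInfo μ).toReal - 2 * d + (sqMoment μ).toReal := by
  have h := congrArg ENNReal.toReal (relFisherInfo_add hM)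
  rw [ENNReal.toReal_add (relFisherInfo_lt_top hM hJ).ne ENNReal.ofReal_ne_top,
    ENNReal.toReal_add hJ.ne hM.ne, ENNReal.toReal_ofReal (by positivity)] at h
  linarith

theorem fisherInfo_map_affine_lt_top [IsProbabilityMeasure μ] (hJ : fisherInfo μ < ∞) {a : ℝ}
    (ha : 0 < a) (b : EuclideanSpace ℝ (Fin d)) : fisherInfo (μ.map fun x => a • x + b) < ∞ :=
  (fisherInfo_map_affine_le ha b).trans_lt (ENNReal.mul_lt_top ENNReal.ofReal_lt_top hJ)

theorem toReal_fisherInfo_map_affine_le [IsProbabilityMeasure μ] (hJ : fisherInfo μ < ∞) {a : ℝ}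
    (ha : 0 < a) (b : EuclideanSpace ℝ (Fin d)) :
    (fisherInfo (μ.map fun x => a • x + b)).toReal ≤ (fisherInfo μ).toReal / a ^ 2 := by
  have h := ENNReal.toReal_mono (ENNReal.mul_lt_top ENNReal.ofReal_lt_top hJ).ne
    (fisherInfo_map_affine_le (μ := μ) ha b)
  rw [ENNReal.toReal_mul, ENNReal.toReal_ofReal (by positivity)] at h
  rwa [div_eq_inv_mul]

end EntropyPower

/-! ### Second moments and realizations of independent random vectors. -/

section RandomVectors

variable {d : ℕ} {Ω : Type*} [MeasurableSpace Ω] {P : Measure Ω}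
  {X Y : Ω → EuclideanSpace ℝ (Fin d)}

theorem sqMoment_map (hX : Measurable X) :
    sqMoment (P.map X) = ∫⁻ ω, ENNReal.ofReal (‖X ω‖ ^ 2) ∂P := by
  rw [sqMoment, lintegral_map (by fun_prop) hX]

theorem sqMoment_map_lt_top_iff (hX : Measurable X) :
    sqMoment (P.map X) < ∞ ↔ MemLp X 2 P := by
  rw [memLp_two_iff_integrable_sq_norm hX.aestronglyMeasurable, sqMoment_map hX, Integrable,
    hasFiniteIntegral_iff_ofReal (ae_of_all _ fun ω => sq_nonneg _)]
  exact (and_iff_right (hX.norm.pow_const 2).aestronglyMeasurable).symm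

theorem toReal_sqMoment_map (hX : Measurable X) :
    (sqMoment (P.map X)).toReal = ∫ ω, ‖X ω‖ ^ 2 ∂P := by
  rw [sqMoment_map hX, integral_eq_lintegral_of_nonneg_ae (ae_of_all _ fun ω => sq_nonneg _)
    (hX.norm.pow_const 2).aestronglyMeasurable]

/-- By independence the cross term is the inner product of the means, so it suffices that one of the
two vectors is centered. -/
theorem toReal_sqMoment_map_add [IsProbabilityMeasure P] (hX : Measurable X) (hY : Measurable Y)
    (hXY : IndepFun X Y P) (hX2 : MemLp X 2 P) (hY2 : MemLp Y 2 P) (hX0 : ∫ ω, X ω ∂P = 0)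
    (a b : ℝ) :
    (sqMoment (P.map fun ω => a • X ω + b • Y ω)).toReal
      = a ^ 2 * (sqMoment (P.map X)).toReal + b ^ 2 * (sqMoment (P.map Y)).toReal := by
  have iX := hX2.integrable one_le_two
  have iY := hY2.integrable one_le_two
  have hc : ∫ ω, inner ℝ (X ω) (Y ω) ∂P = 0 := by
    refine (hXY.integral_bilin iX iY (innerSL ℝ)).trans ?_
    rw [hX0, map_zero, zero_apply]
  have hci : Integrable (fun ω => inner ℝ (X ω) (Y ω)) P :=
    hXY.integrable_bilin iX iY (innerSL ℝ)
  rw [toReal_sqMoment_map (by fun_prop), toReal_sqMoment_map hX, toReal_sqMoment_map hY]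
  have sX : Integrable (fun ω => a ^ 2 * ‖X ω‖ ^ 2) P :=
    ((memLp_two_iff_integrable_sq_norm hX2.1).1 hX2).const_mul _
  have sY : Integrable (fun ω => b ^ 2 * ‖Y ω‖ ^ 2) P :=
    ((memLp_two_iff_integrable_sq_norm hY2.1).1 hY2).const_mul _
  have e : ∀ ω, ‖a • X ω + b • Y ω‖ ^ 2
      = a ^ 2 * ‖X ω‖ ^ 2 + 2 * a * b * inner ℝ (X ω) (Y ω) + b ^ 2 * ‖Y ω‖ ^ 2 := fun ω => by
    rw [norm_add_sq_real, norm_smul, norm_smul, real_inner_smul_left, real_inner_smul_right,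
      mul_pow, mul_pow, Real.norm_eq_abs, Real.norm_eq_abs, sq_abs, sq_abs]
    ring
  have s1 : Integrable (fun ω => a ^ 2 * ‖X ω‖ ^ 2 + 2 * a * b * inner ℝ (X ω) (Y ω)) P :=
    sX.add (hci.const_mul _)
  simp only [e]
  rw [integral_add s1 sY, integral_add sX (hci.const_mul _), integral_const_mul,
    integral_const_mul, integral_const_mul, hc]
  ring

/-- Independent random vectors with prescribed laws exist in every universe. -/
theorem exists_indepFun_of_laws (μ ν : Measure (EuclideanSpace ℝ (Fin d)))
    [IsProbabilityMeasure μ] [IsProbabilityMeasure ν] :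
    ∃ (Ω : Type u) (_ : MeasurableSpace Ω) (P : Measure Ω) (_ : IsProbabilityMeasure P)
      (X Y : Ω → EuclideanSpace ℝ (Fin d)), Measurable X ∧ Measurable Y ∧ IndepFun X Y P ∧
      P.map X = μ ∧ P.map Y = ν := by
  -- The model is the product space with its coordinate projections, lifted to the universe `u`.
  have hup : Measurable (ULift.up.{u} :
      EuclideanSpace ℝ (Fin d) × EuclideanSpace ℝ (Fin d) → _) := measurable_up
  have hdown : Measurable (ULift.down.{u} :
      _ → EuclideanSpace ℝ (Fin d) × EuclideanSpace ℝ (Fin d)) := measurable_down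
  have h1 : ((μ.prod ν).map ULift.up.{u}).map (fun ω => ω.down.1) = μ := by
    rw [Measure.map_map (by fun_prop) hup]
    exact (Measure.map_fst_prod (μ := μ) (ν := ν)).trans (by simp)
  have h2 : ((μ.prod ν).map ULift.up.{u}).map (fun ω => ω.down.2) = ν := by
    rw [Measure.map_map (by fun_prop) hup]
    exact (Measure.map_snd_prod (μ := μ) (ν := ν)).trans (by simp)
  have hP : IsProbabilityMeasure ((μ.prod ν).map ULift.up.{u}) :=
    Measure.isProbabilityMeasure_map hup.aemeasurable
  refine ⟨ULift.{u} (EuclideanSpace ℝ (Fin d) × EuclideanSpace ℝ (Fin d)), inferInstance,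
    (μ.prod ν).map ULift.up, hP, fun ω => ω.down.1, fun ω => ω.down.2, by fun_prop, by fun_prop,
    ?_, h1, h2⟩
  rw [indepFun_iff_map_prod_eq_prod_map_map (by fun_prop) (by fun_prop), h1, h2,
    Measure.map_map (by fun_prop) hup]
  exact Measure.map_id

theorem integral_id_stdGauss (d : ℕ) : ∫ x, x ∂(stdGauss d) = 0 := by
  rw [stdGauss_eq, integral_withDensity_eq_integral_toReal_smul
    (measurable_gaussDensity d).ennreal_ofReal (ae_of_all _ fun x => ENNReal.ofReal_lt_top)]
  have h := integral_neg_eq_self (fun x => (ENNReal.ofReal (gaussDensity d x)).toReal • x)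
    (volume : Measure (EuclideanSpace ℝ (Fin d)))
  have e : ∀ x : EuclideanSpace ℝ (Fin d), gaussDensity d (-x) = gaussDensity d x := fun x => by
    simp [gaussDensity]
  simp only [e, smul_neg, integral_neg] at h
  have h2 := neg_eq_iff_add_eq_zero.1 h
  rw [← two_smul ℝ] at h2
  exact (smul_eq_zero.1 h2).resolve_left two_ne_zero

end RandomVectors

/-! ### The intermediate pair: its relation to (B), and (C) as a consequence. -/

section Equivalence

variable {d : ℕ}

/-- Stam's inequality `N J ≥ d`, in logarithmic form, together with the finiteness of the
entropy and the positivity of the Fisher information. -/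
def StamInequality (d : ℕ) : Prop :=
  ∀ (μ : Measure (EuclideanSpace ℝ (Fin d))) [IsProbabilityMeasure μ],
    sqMoment μ < ∞ → fisherInfo μ < ∞ → ∃ r : ℝ, diffEntropy μ = r ∧ 0 < (fisherInfo μ).toReal ∧
      d / 2 * (1 + Real.log (2 * Real.pi) - Real.log ((fisherInfo μ).toReal / d)) ≤ r

/-- The reverse entropy power inequality for laws with finite entropy and Fisher information, in
logarithmic form. -/
def EntropySumBound (d : ℕ) : Prop :=
  ∀ (Ω : Type u) [MeasurableSpace Ω] (P : Measure Ω) [IsProbabilityMeasure P]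
    (X Y : Ω → EuclideanSpace ℝ (Fin d)),
    Measurable X → Measurable Y → IndepFun X Y P → MemLp X 2 P → MemLp Y 2 P →
    fisherInfo (P.map X) < ∞ → fisherInfo (P.map Y) < ∞ → ∀ r s t : ℝ,
      diffEntropy (P.map X) = r → diffEntropy (P.map Y) = s →
      diffEntropy (P.map fun ω => X ω + Y ω) = t →
      t ≤ r + s + d / 2 * (Real.log (((fisherInfo (P.map X)).toReal
        + (fisherInfo (P.map Y)).toReal) / d) - 1 - Real.log (2 * Real.pi))

/-- Take logarithms and multiply by d/2. The product form is what (B) and (C) speak of; the additive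
form is what D and I lead to. -/
theorem realEntropyPower_le_mul_iff (hd : 0 < d) (r s t : ℝ) {T : ℝ} (hT : 0 < T) :
    realEntropyPower d t ≤ realEntropyPower d r * realEntropyPower d s * T ↔
      t ≤ r + s + d / 2 * (Real.log T - 1 - Real.log (2 * Real.pi)) := by
  have hr := realEntropyPower_pos (d := d) r
  have hs := realEntropyPower_pos (d := d) s
  have hd' : (0 : ℝ) < d := by positivity
  rw [← Real.log_le_log_iff (realEntropyPower_pos t) (by positivity),
    Real.log_mul (by positivity) hT.ne', Real.log_mul hr.ne' hs.ne', log_realEntropyPower,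
    log_realEntropyPower, log_realEntropyPower]
  have e : ∀ x : ℝ, 2 / (d : ℝ) * x = x / (d / 2) := fun x => by field_simp
  rw [e, e, e, ← sub_nonneg, ← sub_nonneg (b := t)]
  have : r / (↑d / 2) - Real.log (2 * Real.pi) - 1 + (s / (↑d / 2) - Real.log (2 * Real.pi) - 1)
      + Real.log T - (t / (↑d / 2) - Real.log (2 * Real.pi) - 1)
      = (r + s + ↑d / 2 * (Real.log T - 1 - Real.log (2 * Real.pi)) - t) / (d / 2) := by
    field_simp; ring
  rw [this, div_nonneg_iff]
  constructor
  · rintro (⟨h, -⟩ | ⟨-, h⟩)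
    · exact h
    · linarith
  · intro h; exact Or.inl ⟨h, by positivity⟩

theorem le_realEntropyPower_iff (hd : 0 < d) (r : ℝ) {J : ℝ} (hJ : 0 < J) :
    1 ≤ realEntropyPower d r * (J / d) ↔
      d / 2 * (1 + Real.log (2 * Real.pi) - Real.log (J / d)) ≤ r := by
  have hr := realEntropyPower_pos (d := d) r
  have hd' : (0 : ℝ) < d := by positivity
  rw [← Real.log_le_log_iff one_pos (by positivity), Real.log_one,
    Real.log_mul hr.ne' (by positivity), log_realEntropyPower]
  have : 2 / d * r - Real.log (2 * Real.pi) - 1 + Real.log (J / d)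
      = (r - d / 2 * (1 + Real.log (2 * Real.pi) - Real.log (J / d))) / (d / 2) := by
    field_simp; ring
  rw [this, ← sub_nonneg (b := (d : ℝ) / 2 * _), div_nonneg_iff]
  constructor
  · rintro (⟨h, -⟩ | ⟨-, h⟩)
    · exact h
    · linarith
  · intro h; exact Or.inl ⟨h, by positivity⟩

theorem map_affine_comp {Ω : Type*} [MeasurableSpace Ω] {P : Measure Ω}
    {X : Ω → EuclideanSpace ℝ (Fin d)} (hX : Measurable X) (a : ℝ) (b : EuclideanSpace ℝ (Fin d)) :
    (P.map X).map (fun x => a • x + b) = P.map fun ω => a • X ω + b :=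
  Measure.map_map (by fun_prop) hX

theorem diffEntropy_ne_top_cases {μ : Measure (EuclideanSpace ℝ (Fin d))} [IsProbabilityMeasure μ]
    (hM : sqMoment μ < ∞) : diffEntropy μ = ⊥ ∨ ∃ r : ℝ, diffEntropy μ = r := by
  rcases entropy_dichotomy hM with ⟨h, -⟩ | ⟨r, h, -⟩
  exacts [Or.inl h, Or.inr ⟨r, h⟩]

/-- The reverse entropy power inequality, for laws with finite entropy and Fisher information. -/
theorem ReverseEPI.realEntropyPower_le (hB : ReverseEPI.{u} d) (hd : 0 < d) {Ω : Type u}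
    [MeasurableSpace Ω] {P : Measure Ω} [IsProbabilityMeasure P]
    {X Y : Ω → EuclideanSpace ℝ (Fin d)} (hX : Measurable X) (hY : Measurable Y)
    (hXY : IndepFun X Y P) (hX2 : MemLp X 2 P) (hY2 : MemLp Y 2 P)
    (hJX : fisherInfo (P.map X) < ∞) (hJY : fisherInfo (P.map Y) < ∞) {r s t : ℝ}
    (hr : diffEntropy (P.map X) = r) (hs : diffEntropy (P.map Y) = s)
    (ht : diffEntropy (P.map fun ω => X ω + Y ω) = t) :
    realEntropyPower d t ≤ realEntropyPower d r * realEntropyPower d s *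
      (((fisherInfo (P.map X)).toReal + (fisherInfo (P.map Y)).toReal) / d) := by
  have ha := realEntropyPower_pos (d := d) r
  have hb := realEntropyPower_pos (d := d) s
  set a := realEntropyPower d r with hadef
  set b := realEntropyPower d s with hbdef
  have hab : 0 < a + b := by positivity
  have hl : 1 - b / (a + b) = a / (a + b) := by field_simp; ring
  have h := hB Ω P X Y hX hY hXY hX2 hY2
    (Or.inl (by rw [entropyPower_eq_ofReal hr]; simpa using ha)) (b / (a + b)) (by positivity)
    ((div_le_one hab).2 (by linarith)) (by
      rw [hl, entropyPower_eq_ofReal hr, entropyPower_eq_ofReal hs, ← hadef, ← hbdef,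
        ← ENNReal.ofReal_div_of_pos (by positivity), ← ENNReal.ofReal_div_of_pos (by positivity)]
      congr 1; field_simp)
  have hJX0 : 0 ≤ (fisherInfo (P.map X)).toReal := ENNReal.toReal_nonneg
  have hJY0 : 0 ≤ (fisherInfo (P.map Y)).toReal := ENNReal.toReal_nonneg
  rw [hl, stamDefect_eq_ofReal hd hr hJX, stamDefect_eq_ofReal hd hs hJY,
    entropyPower_eq_ofReal hr, entropyPower_eq_ofReal hs, entropyPower_eq_ofReal ht,
    ← ENNReal.ofReal_add (by positivity) (by positivity),
    ← ENNReal.ofReal_mul (by positivity), ← ENNReal.ofReal_mul (by positivity),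
    ← ENNReal.ofReal_add (by positivity) (by positivity), ← ENNReal.ofReal_mul (by positivity),
    ENNReal.ofReal_le_ofReal_iff (by positivity)] at h
  refine h.trans (le_of_eq ?_)
  have hd' : (d : ℝ) ≠ 0 := by positivity
  -- The weights are chosen so that λ N(X) = (1-λ) N(Y) = ab/(a+b), which collapses the right side
  -- of (B).
  change (a + b) * (b / (a + b) * (a * _ / d) + a / (a + b) * (b * _ / d)) = a * b * _
  field_simp

theorem ReverseEPI.entropySumBound (hB : ReverseEPI.{u} d) (hS : StamInequality d) (hd : 0 < d) :
    EntropySumBound.{u} d := by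
  intro Ω _ P _ X Y hX hY hXY hX2 hY2 hJX hJY r s t hr hs ht
  have hPX : IsProbabilityMeasure (P.map X) := Measure.isProbabilityMeasure_map hX.aemeasurable
  obtain ⟨-, -, hpos, -⟩ := hS (P.map X) ((sqMoment_map_lt_top_iff hX).2 hX2) hJX
  have hJY0 : 0 ≤ (fisherInfo (P.map Y)).toReal := ENNReal.toReal_nonneg
  exact (realEntropyPower_le_mul_iff hd r s t (by positivity)).1
    (hB.realEntropyPower_le hd hX hY hXY hX2 hY2 hJX hJY hr hs ht)

/-- (B) is applied to `μ` and a dilate of an independent copy by a factor a → ∞: the dilate's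
entropy power cancels and its Fisher information disappears in the limit. -/
theorem ReverseEPI.stamInequality (hB : ReverseEPI.{u} d) (hd : 0 < d) : StamInequality d := by
  intro μ _ hM hJ
  have hd' : (0 : ℝ) < d := by positivity
  have hconv : ∀ (Ω : Type u) [MeasurableSpace Ω] (P : Measure Ω) [IsProbabilityMeasure P]
      (X Y : Ω → EuclideanSpace ℝ (Fin d)), Measurable X → Measurable Y → IndepFun X Y P →
      MemLp X 2 P → MemLp Y 2 P → ∀ s : ℝ, diffEntropy (P.map Y) = s →
      ∃ t : ℝ, s ≤ t ∧ diffEntropy (P.map fun ω => X ω + Y ω) = t := by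
    intro Ω _ P _ X Y hX hY hXY hX2 hY2 s hs
    have hPX : IsProbabilityMeasure (P.map X) := Measure.isProbabilityMeasure_map hX.aemeasurable
    have hPY : IsProbabilityMeasure (P.map Y) := Measure.isProbabilityMeasure_map hY.aemeasurable
    have he : P.map (fun ω => X ω + Y ω) = (P.map X).conv (P.map Y) :=
      hXY.map_add_eq_map_conv_map hX hY
    have hm : sqMoment (P.map fun ω => X ω + Y ω) < ∞ :=
      (sqMoment_map_lt_top_iff (hX.add hY)).2 (hX2.add hY2)
    rw [he] at hm ⊢
    exact diffEntropy_le_conv hs hm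
  -- If h(X) = -∞ while J(X) < ∞, then p(X) = 0. With Gaussian Y the weight is λ = 1, so (B) gives
  -- N(X+Y) = 0, contradicting h(X+Y) ≥ h(Y) > -∞.
  obtain ⟨r, hr⟩ : ∃ r : ℝ, diffEntropy μ = r := by
    rcases diffEntropy_ne_top_cases hM with hbot | h
    swap
    · exact h
    exfalso
    obtain ⟨Ω, _, P, _, X, Y, hX, hY, hXY, hμX, hνY⟩ := exists_indepFun_of_laws.{u} μ (stdGauss d)
    have hX2 : MemLp X 2 P := (sqMoment_map_lt_top_iff hX).1 (by rwa [hμX])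
    have hY2 : MemLp Y 2 P :=
      (sqMoment_map_lt_top_iff hY).1 (by rw [hνY]; exact sqMoment_stdGauss_lt_top d)
    obtain ⟨s, hs⟩ := exists_diffEntropy_eq_of_relEntropy_ne_top (sqMoment_stdGauss_lt_top d)
      (by rw [relEntropy_stdGauss]; exact ENNReal.zero_ne_top)
    obtain ⟨t, -, ht⟩ := hconv Ω P X Y hX hY hXY hX2 hY2 s (by rw [hνY, hs])
    have hNX : entropyPower (P.map X) = 0 := by rw [hμX]; exact entropyPower_eq_zero hbot hd
    have hNY : entropyPower (P.map Y) ≠ 0 := by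
      rw [hνY, entropyPower_eq_ofReal hs]; simpa using realEntropyPower_pos s
    have h := hB Ω P X Y hX hY hXY hX2 hY2 (Or.inr hNY) 1 zero_le_one le_rfl (by
      rw [hNX, ENNReal.div_zero hNY]; simp)
    have hst : stamDefect (P.map X) = 0 := by
      rw [stamDefect, if_neg (by rw [hμX]; exact hJ.ne), hNX]; simp
    rw [hst, entropyPower_eq_ofReal ht] at h
    have : realEntropyPower d t ≤ 0 := by simpa using h
    exact absurd (realEntropyPower_pos t) (not_lt.2 this)
  have key : ∀ a : ℝ, 0 < a →
      1 ≤ realEntropyPower d r * (((fisherInfo μ).toReal + (fisherInfo μ).toReal / a ^ 2) / d) := by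
    intro a ha
    have hm : Measurable fun x : EuclideanSpace ℝ (Fin d) => a • x + 0 := by fun_prop
    have hν : IsProbabilityMeasure (μ.map fun x => a • x + 0) :=
      Measure.isProbabilityMeasure_map hm.aemeasurable
    obtain ⟨Ω, _, P, _, X, Y, hX, hY, hXY, hμX, hνY⟩ :=
      exists_indepFun_of_laws.{u} μ (μ.map fun x => a • x + 0)
    have hX2 : MemLp X 2 P := (sqMoment_map_lt_top_iff hX).1 (by rwa [hμX])
    have hid : MemLp (fun x : EuclideanSpace ℝ (Fin d) => x) 2 μ :=
      (sqMoment_map_lt_top_iff measurable_id).1 (by rwa [Measure.map_id])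
    have hY2 : MemLp Y 2 P := (sqMoment_map_lt_top_iff hY).1 (by
      rw [hνY, sqMoment_map_lt_top_iff hm]; simp only [add_zero]; exact hid.const_smul a)
    have hs := diffEntropy_map_affine hr ha 0
    rw [← hνY] at hs
    obtain ⟨t, hst, ht⟩ := hconv Ω P X Y hX hY hXY hX2 hY2 _ hs
    have hJY : fisherInfo (P.map Y) < ∞ := by rw [hνY]; exact fisherInfo_map_affine_lt_top hJ ha 0
    have hJX : fisherInfo (P.map X) < ∞ := by rwa [hμX]
    have h := hB.realEntropyPower_le hd hX hY hXY hX2 hY2 hJX hJY (by rw [hμX]; exact hr) hs ht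
    have h2 := (realEntropyPower_mono hst).trans h
    have hJle : (fisherInfo (P.map Y)).toReal ≤ (fisherInfo μ).toReal / a ^ 2 := by
      rw [hνY]; exact toReal_fisherInfo_map_affine_le hJ ha 0
    have hp := realEntropyPower_pos (d := d) (r + d * Real.log a)
    have hpr := realEntropyPower_pos (d := d) r
    rw [hμX, mul_right_comm] at h2
    have h3 : 1 ≤ realEntropyPower d r *
        (((fisherInfo μ).toReal + (fisherInfo (P.map Y)).toReal) / d) := by
      by_contra hlt
      nlinarith
    refine h3.trans ?_
    gcongr
  have hN := realEntropyPower_pos (d := d) r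
  set J := (fisherInfo μ).toReal with hJdef
  have hJ0 : 0 ≤ J := ENNReal.toReal_nonneg
  have hlim : Filter.Tendsto (fun n : ℕ => realEntropyPower d r *
      ((J + J / (n : ℝ) ^ 2) / d)) Filter.atTop (nhds (realEntropyPower d r * ((J + 0) / d))) := by
    refine Filter.Tendsto.const_mul _ (Filter.Tendsto.div_const (Filter.Tendsto.const_add _ ?_) _)
    exact Filter.Tendsto.div_atTop tendsto_const_nhds
      ((Filter.tendsto_pow_atTop two_ne_zero).comp tendsto_natCast_atTop_atTop)
  have h1 : 1 ≤ realEntropyPower d r * (J / d) := by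
    have := ge_of_tendsto hlim (b := 1) (by
      filter_upwards [Filter.eventually_gt_atTop 0] with n hn
      exact key n (by exact_mod_cast hn))
    simpa using this
  have hJpos : 0 < J := by
    rcases hJ0.lt_or_eq with h | h
    · exact h
    · rw [← h] at h1; norm_num at h1
  exact ⟨r, hr, hJpos, (le_realEntropyPower_iff hd r hJpos).1 h1⟩

theorem ReverseEPI.of_entropySumBound (hK : EntropySumBound.{u} d) (hS : StamInequality d)
    (hd : 0 < d) : ReverseEPI.{u} d := by
  intro Ω _ P _ X Y hX hY hXY hX2 hY2 hN l hl0 hl1 hl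
  have hPX : IsProbabilityMeasure (P.map X) := Measure.isProbabilityMeasure_map hX.aemeasurable
  have hPY : IsProbabilityMeasure (P.map Y) := Measure.isProbabilityMeasure_map hY.aemeasurable
  have hPS : IsProbabilityMeasure (P.map fun ω => X ω + Y ω) :=
    Measure.isProbabilityMeasure_map (hX.add hY).aemeasurable
  have hMX := (sqMoment_map_lt_top_iff hX).2 hX2
  have hMY := (sqMoment_map_lt_top_iff hY).2 hY2
  have hMS : sqMoment (P.map fun ω => X ω + Y ω) < ∞ :=
    (sqMoment_map_lt_top_iff (hX.add hY)).2 (hX2.add hY2)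
  -- By Stam's inequality, h = -∞ is impossible for finite J, so such a law has infinite defect; the
  -- weight in (B) then falls entirely on it, and the right side is infinite.
  have hbot : ∀ μ : Measure (EuclideanSpace ℝ (Fin d)), IsProbabilityMeasure μ → sqMoment μ < ∞ →
      diffEntropy μ = ⊥ → stamDefect μ = ∞ := by
    intro μ _ hM h
    rw [stamDefect, if_pos]
    by_contra hJ
    obtain ⟨r, hr, -⟩ := hS μ hM (lt_top_iff_ne_top.2 hJ)
    rw [h] at hr; exact EReal.bot_ne_coe r hr
  rcases diffEntropy_ne_top_cases hMX with hr | ⟨r, hr⟩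
  · have hNX := entropyPower_eq_zero hr hd
    have hNY : entropyPower (P.map Y) ≠ 0 := hN.resolve_left (not_not.2 hNX)
    have hl' : l = 1 := by
      rw [hNX, ENNReal.div_zero hNY, ENNReal.div_eq_top] at hl
      rcases hl with ⟨-, h⟩ | ⟨h, -⟩
      · rw [ENNReal.ofReal_eq_zero] at h; linarith
      · exact absurd h ENNReal.ofReal_ne_top
    rw [hbot _ hPX hMX hr, hNX, hl', ENNReal.ofReal_one, one_mul, zero_add, top_add,
      ENNReal.mul_top hNY]
    exact le_top
  rcases diffEntropy_ne_top_cases hMY with hs | ⟨s, hs⟩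
  · have hNY := entropyPower_eq_zero hs hd
    have hNX : entropyPower (P.map X) ≠ 0 := hN.resolve_right (not_not.2 hNY)
    have hl' : l = 0 := by
      rw [hNY, ENNReal.zero_div, ENNReal.div_eq_zero_iff] at hl
      rcases hl with h | h
      · rw [ENNReal.ofReal_eq_zero] at h; linarith
      · exact absurd h ENNReal.ofReal_ne_top
    rw [hbot _ hPY hMY hs, hNY, hl', sub_zero, ENNReal.ofReal_one, one_mul, add_zero, add_top,
      ENNReal.mul_top hNX]
    exact le_top
  have ha := realEntropyPower_pos (d := d) r
  have hb := realEntropyPower_pos (d := d) s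
  have hNX := entropyPower_eq_ofReal hr
  have hNY := entropyPower_eq_ofReal hs
  set a := realEntropyPower d r with hadef
  set b := realEntropyPower d s with hbdef
  -- At l = 1 the left ratio is 1/0 = ∞, whereas the ratio of two positive finite entropy powers is
  -- finite.
  have hl1' : 0 < 1 - l := by
    rcases hl1.lt_or_eq with h | h
    · linarith
    · rw [h, sub_self, ENNReal.ofReal_zero, ENNReal.div_zero (by simp), hNX, hNY,
        ← ENNReal.ofReal_div_of_pos ha] at hl
      exact absurd hl.symm ENNReal.ofReal_ne_top
  rw [hNX, hNY, ← ENNReal.ofReal_div_of_pos ha, ← ENNReal.ofReal_div_of_pos hl1',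
    ENNReal.ofReal_eq_ofReal_iff (by positivity) (by positivity), div_eq_div_iff hl1'.ne' ha.ne'] at hl
  have hl0' : 0 < l := by
    rcases hl0.lt_or_eq with h | h
    · exact h
    · rw [← h] at hl; nlinarith
  have hsum : entropyPower (P.map X) + entropyPower (P.map Y) ≠ 0 := by
    rw [hNX]; simp [ha]
  by_cases hJX : fisherInfo (P.map X) = ∞
  · have : stamDefect (P.map X) = ∞ := by rw [stamDefect, if_pos hJX]
    rw [this, ENNReal.mul_top (by simpa using hl0'), top_add, ENNReal.mul_top hsum]
    exact le_top
  by_cases hJY : fisherInfo (P.map Y) = ∞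
  · have : stamDefect (P.map Y) = ∞ := by rw [stamDefect, if_pos hJY]
    rw [this, ENNReal.mul_top (by simpa using hl1'), add_top, ENNReal.mul_top hsum]
    exact le_top
  have hJX' := lt_top_iff_ne_top.2 hJX
  have hJY' := lt_top_iff_ne_top.2 hJY
  rcases diffEntropy_ne_top_cases hMS with ht | ⟨t, ht⟩
  · rw [entropyPower_eq_zero ht hd]; exact zero_le
  obtain ⟨-, -, hJX0, -⟩ := hS _ hMX hJX'
  obtain ⟨-, -, hJY0, -⟩ := hS _ hMY hJY'
  have h := (realEntropyPower_le_mul_iff hd r s t (by positivity)).2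
    (hK Ω P X Y hX hY hXY hX2 hY2 hJX' hJY' r s t hr hs ht)
  rw [stamDefect_eq_ofReal hd hr hJX', stamDefect_eq_ofReal hd hs hJY', hNX, hNY,
    entropyPower_eq_ofReal ht, ← ENNReal.ofReal_add ha.le hb.le,
    ← ENNReal.ofReal_mul hl0, ← ENNReal.ofReal_mul hl1'.le,
    ← ENNReal.ofReal_add (by positivity) (by positivity), ← ENNReal.ofReal_mul (by positivity)]
  refine ENNReal.ofReal_le_ofReal (h.trans (le_of_eq ?_))
  have hlb : l = b / (a + b) := by field_simp; linarith
  have hla : 1 - l = a / (a + b) := by rw [hlb]; field_simp; ring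
  rw [hla, hlb, ← hadef, ← hbdef]
  field_simp

/-- Stam's inequality for the sum and the sum bound give 1/J(X+Y) ≤ N(X+Y)/d ≤ N(X) N(Y)
(J(X)+J(Y))/d², and the last expression is the right side of (C). -/
theorem ReverseFII.of_entropySumBound (hK : EntropySumBound.{u} d) (hS : StamInequality d)
    (hd : 0 < d) : ReverseFII.{u} d := by
  intro Ω _ P _ X Y hX hY hXY hX2 hY2 hJX hJY
  have hPX : IsProbabilityMeasure (P.map X) := Measure.isProbabilityMeasure_map hX.aemeasurable
  have hPY : IsProbabilityMeasure (P.map Y) := Measure.isProbabilityMeasure_map hY.aemeasurable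
  have hPS : IsProbabilityMeasure (P.map fun ω => X ω + Y ω) :=
    Measure.isProbabilityMeasure_map (hX.add hY).aemeasurable
  have hMS : sqMoment (P.map fun ω => X ω + Y ω) < ∞ :=
    (sqMoment_map_lt_top_iff (hX.add hY)).2 (hX2.add hY2)
  obtain ⟨r, hr, hJX0, -⟩ := hS _ ((sqMoment_map_lt_top_iff hX).2 hX2) hJX
  obtain ⟨s, hs, hJY0, -⟩ := hS _ ((sqMoment_map_lt_top_iff hY).2 hY2) hJY
  by_cases hJS : fisherInfo (P.map fun ω => X ω + Y ω) = ∞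
  · rw [hJS, ENNReal.div_top]; exact zero_le
  obtain ⟨t, ht, hJS0, hstam⟩ := hS _ hMS (lt_top_iff_ne_top.2 hJS)
  have h := (realEntropyPower_le_mul_iff hd r s t (by positivity)).2
    (hK Ω P X Y hX hY hXY hX2 hY2 hJX hJY r s t hr hs ht)
  have h2 := (le_realEntropyPower_iff hd t hJS0).2 hstam
  have ha := realEntropyPower_pos (d := d) r
  have hb := realEntropyPower_pos (d := d) s
  rw [stamDefect_eq_ofReal hd hr hJX, stamDefect_eq_ofReal hd hs hJY]
  have hof : ∀ x : ℝ≥0∞, x < ∞ → 0 < x.toReal → 1 / x = ENNReal.ofReal (1 / x.toReal) := by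
    intro x hx hx0
    rw [ENNReal.ofReal_div_of_pos hx0, ENNReal.ofReal_one, ENNReal.ofReal_toReal hx.ne]
  rw [hof _ (lt_top_iff_ne_top.2 hJS) hJS0, hof _ hJX hJX0, hof _ hJY hJY0,
    ← ENNReal.ofReal_add (by positivity) (by positivity), ← ENNReal.ofReal_mul (by positivity),
    ← ENNReal.ofReal_mul (by positivity)]
  refine ENNReal.ofReal_le_ofReal ?_
  set JX := (fisherInfo (P.map X)).toReal
  set JY := (fisherInfo (P.map Y)).toReal
  set JS := (fisherInfo (P.map fun ω => X ω + Y ω)).toReal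
  set a := realEntropyPower d r
  set b := realEntropyPower d s
  have hd' : (0 : ℝ) < d := by positivity
  have e : (1 / JX + 1 / JY) * (a * JX / d * (b * JY / d)) = a * b * ((JX + JY) / d) / d := by
    field_simp; ring
  rw [e, div_le_iff₀ hJS0]
  calc (1 : ℝ) ≤ realEntropyPower d t * (JS / d) := h2
    _ ≤ a * b * ((JX + JY) / d) * (JS / d) := by gcongr
    _ = a * b * ((JX + JY) / d) / d * JS := by ring

end Equivalence

/-! ### The intermediate pair and the interpolation inequality (A). -/

section Interpolation

variable {d : ℕ}

theorem integral_smul_sub_integral {Ω : Type*} [MeasurableSpace Ω] {P : Measure Ω}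
    [IsProbabilityMeasure P] {Z : Ω → EuclideanSpace ℝ (Fin d)} (hZ : Integrable Z P) (a : ℝ) :
    ∫ ω, (a • Z ω + -(a • ∫ ω, Z ω ∂P)) ∂P = 0 := by
  have h : Integrable (fun ω => a • Z ω) P := hZ.smul a
  rw [integral_add h (integrable_const _), integral_smul, integral_const]
  simp

theorem integral_id_map {Ω : Type*} [MeasurableSpace Ω] {P : Measure Ω}
    {Z : Ω → EuclideanSpace ℝ (Fin d)} (hZ : Measurable Z) :
    ∫ x, x ∂(P.map Z) = ∫ ω, Z ω ∂P :=
  integral_map hZ.aemeasurable (f := fun x => x) aestronglyMeasurable_id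

/-- The logarithmic Sobolev inequality is the case `θ = 0` of the interpolation inequality. -/
theorem InterpolationInequality.relEntropy_le (hA : InterpolationInequality.{u} d)
    {μ : Measure (EuclideanSpace ℝ (Fin d))} [IsProbabilityMeasure μ] (hM : sqMoment μ < ∞)
    (h0 : ∫ x, x ∂μ = 0) : relEntropy μ ≤ ENNReal.ofReal (1 / 2) * relFisherInfo μ := by
  obtain ⟨Ω, _, P, _, X, Y, hX, hY, hXY, hμX, hνY⟩ := exists_indepFun_of_laws.{u} μ (stdGauss d)
  have hX2 : MemLp X 2 P := (sqMoment_map_lt_top_iff hX).1 (by rwa [hμX])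
  have hY2 : MemLp Y 2 P :=
    (sqMoment_map_lt_top_iff hY).1 (by rw [hνY]; exact sqMoment_stdGauss_lt_top d)
  have hX0 : ∫ ω, X ω ∂P = 0 := by
    rw [← integral_id_map hX, hμX, h0]
  have hY0 : ∫ ω, Y ω ∂P = 0 := by
    rw [← integral_id_map hY, hνY, integral_id_stdGauss]
  -- At θ = 0 the combined vector is Y itself, whose relative entropy is zero, and I(Y) has weight
  -- zero.
  have h := hA Ω P X Y hX hY hXY (hX2.integrable one_le_two) hX0 (hY2.integrable one_le_two) hY0
    0 le_rfl zero_le_one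
  simpa [hμX, hνY, relEntropy_stdGauss] using h

/-- In the logarithmic Sobolev inequality for the centered dilate by a, the second moments cancel
and leave -h(X) - d log a + (d/2) log 2π ≤ J/(2a²) - d. The optimal choice is a² = J/d. -/
theorem InterpolationInequality.stamInequality (hA : InterpolationInequality.{u} d) (hd : 0 < d) :
    StamInequality d := by
  intro μ _ hM hJ
  have hd' : (0 : ℝ) < d := by positivity
  have hid : MemLp (fun x : EuclideanSpace ℝ (Fin d) => x) 2 μ :=
    (sqMoment_map_lt_top_iff measurable_id).1 (by rwa [Measure.map_id])
  set m := ∫ x, x ∂μ with hm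
  have step : ∀ a : ℝ, 0 < a → ∃ s : ℝ, diffEntropy (μ.map fun x => a • x + -(a • m)) = s ∧
      -s + d / 2 * Real.log (2 * Real.pi) ≤ (fisherInfo μ).toReal / (2 * a ^ 2) - d := by
    intro a ha
    have hT : Measurable fun x : EuclideanSpace ℝ (Fin d) => a • x + -(a • m) := by fun_prop
    have hν : IsProbabilityMeasure (μ.map fun x => a • x + -(a • m)) :=
      Measure.isProbabilityMeasure_map hT.aemeasurable
    have hMν : sqMoment (μ.map fun x => a • x + -(a • m)) < ∞ := by
      rw [sqMoment_map_lt_top_iff hT]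
      exact (hid.const_smul a).add (memLp_const _)
    have hJν := fisherInfo_map_affine_lt_top hJ ha (-(a • m))
    have hν0 : ∫ x, x ∂(μ.map fun x => a • x + -(a • m)) = 0 := by
      rw [integral_id_map hT]
      exact integral_smul_sub_integral (hid.integrable one_le_two) a
    have hle := hA.relEntropy_le hMν hν0
    have hI := relFisherInfo_lt_top hMν hJν
    obtain ⟨s, hs⟩ := exists_diffEntropy_eq_of_relEntropy_ne_top hMν
      (hle.trans_lt (ENNReal.mul_lt_top ENNReal.ofReal_lt_top hI)).ne
    obtain ⟨hnn, hD⟩ := relEntropy_eq_ofReal hMν hs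
    refine ⟨s, hs, ?_⟩
    rw [hD, ← ENNReal.ofReal_toReal hI.ne, ← ENNReal.ofReal_mul (by positivity),
      ENNReal.ofReal_le_ofReal_iff (by positivity), toReal_relFisherInfo hMν hJν] at hle
    have hJle := toReal_fisherInfo_map_affine_le hJ ha (-(a • m))
    have : (fisherInfo μ).toReal / (2 * a ^ 2) = (fisherInfo μ).toReal / a ^ 2 / 2 := by
      field_simp
    rw [this]
    linarith
  obtain ⟨r, hr⟩ : ∃ r : ℝ, diffEntropy μ = r := by
    obtain ⟨s, hs, -⟩ := step 1 one_pos
    have hT : Measurable fun x : EuclideanSpace ℝ (Fin d) => (1 : ℝ) • x + -((1 : ℝ) • m) := by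
      fun_prop
    have hν : IsProbabilityMeasure (μ.map fun x => (1 : ℝ) • x + -((1 : ℝ) • m)) :=
      Measure.isProbabilityMeasure_map hT.aemeasurable
    have h := diffEntropy_map_affine hs one_pos m
    rw [Measure.map_map (by fun_prop) hT] at h
    have he : ((fun x => (1 : ℝ) • x + m) ∘ fun x : EuclideanSpace ℝ (Fin d) =>
        (1 : ℝ) • x + -((1 : ℝ) • m)) = id := by
      ext x; simp
    rw [he, Measure.map_id] at h
    exact ⟨_, h⟩
  have key : ∀ a : ℝ, 0 < a → -(r + d * Real.log a) + d / 2 * Real.log (2 * Real.pi)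
      ≤ (fisherInfo μ).toReal / (2 * a ^ 2) - d := by
    intro a ha
    obtain ⟨s, hs, hle⟩ := step a ha
    rw [diffEntropy_map_affine hr ha] at hs
    rwa [← EReal.coe_injective hs] at hle
  have hJpos : 0 < (fisherInfo μ).toReal := by
    rcases (ENNReal.toReal_nonneg (a := fisherInfo μ)).lt_or_eq with h | h
    · exact h
    · exfalso
      -- If J = 0 the right side is -d for every a; this a makes the left side 0.
      have := key (Real.exp ((d / 2 * Real.log (2 * Real.pi) - r) / d)) (Real.exp_pos _)
      rw [← h, Real.log_exp, zero_div, mul_div_cancel₀ _ hd'.ne'] at this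
      linarith
  refine ⟨r, hr, hJpos, ?_⟩
  have h := key (√((fisherInfo μ).toReal / d)) (by positivity)
  rw [Real.sq_sqrt (by positivity), Real.log_sqrt (by positivity)] at h
  have e : (fisherInfo μ).toReal / (2 * ((fisherInfo μ).toReal / d)) = d / 2 := by field_simp
  rw [e] at h
  linarith

theorem InterpolationInequality.entropySumBound (hA : InterpolationInequality.{u} d)
    (hS : StamInequality d) (hd : 0 < d) : EntropySumBound.{u} d := by
  intro Ω _ P _ X Y hX hY hXY hX2 hY2 hJX hJY r s t hr hs ht
  have hd' : (0 : ℝ) < d := by positivity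
  have hPX : IsProbabilityMeasure (P.map X) := Measure.isProbabilityMeasure_map hX.aemeasurable
  have hPY : IsProbabilityMeasure (P.map Y) := Measure.isProbabilityMeasure_map hY.aemeasurable
  have hPS : IsProbabilityMeasure (P.map fun ω => X ω + Y ω) :=
    Measure.isProbabilityMeasure_map (hX.add hY).aemeasurable
  obtain ⟨-, -, hJX0, -⟩ := hS _ ((sqMoment_map_lt_top_iff hX).2 hX2) hJX
  obtain ⟨-, -, hJY0, -⟩ := hS _ ((sqMoment_map_lt_top_iff hY).2 hY2) hJY
  set JX := (fisherInfo (P.map X)).toReal with hJXdef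
  set JY := (fisherInfo (P.map Y)).toReal with hJYdef
  -- For the vectors dilated by ρ, the case θ = 1/2 of (A) bounds h(X+Y) by a ρ-independent
  -- expression plus d log ρ + (J(X)+J(Y))/(4ρ²), and this ρ is the minimizer. The second moments
  -- cancel once the vectors are centered.
  obtain ⟨ρ, hρ0, hρ2⟩ : ∃ ρ : ℝ, 0 < ρ ∧ ρ ^ 2 = (JX + JY) / (2 * d) :=
    ⟨√((JX + JY) / (2 * d)), by positivity, Real.sq_sqrt (by positivity)⟩
  have center : ∀ Z : Ω → EuclideanSpace ℝ (Fin d), Measurable Z → MemLp Z 2 P →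
      fisherInfo (P.map Z) < ∞ → ∀ q : ℝ, diffEntropy (P.map Z) = q →
      ∃ b : EuclideanSpace ℝ (Fin d), MemLp (fun ω => ρ • Z ω + b) 2 P ∧
        ∫ ω, (ρ • Z ω + b) ∂P = 0 ∧
        fisherInfo (P.map fun ω => ρ • Z ω + b) < ∞ ∧
        (fisherInfo (P.map fun ω => ρ • Z ω + b)).toReal ≤ (fisherInfo (P.map Z)).toReal / ρ ^ 2 ∧
        diffEntropy (P.map fun ω => ρ • Z ω + b) = ((q + d * Real.log ρ : ℝ) : EReal) := by
    intro Z hZ hZ2 hJ q hq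
    have hPZ : IsProbabilityMeasure (P.map Z) := Measure.isProbabilityMeasure_map hZ.aemeasurable
    refine ⟨-(ρ • ∫ ω, Z ω ∂P), (hZ2.const_smul ρ).add (memLp_const _),
      integral_smul_sub_integral (hZ2.integrable one_le_two) ρ, ?_⟩
    · rw [← map_affine_comp hZ]
      exact ⟨fisherInfo_map_affine_lt_top hJ hρ0 _, toReal_fisherInfo_map_affine_le hJ hρ0 _,
        diffEntropy_map_affine hq hρ0 _⟩
  obtain ⟨b, hX2', hX0', hJX', hJXle, hr'⟩ := center X hX hX2 hJX r hr
  obtain ⟨c, hY2', hY0', hJY', hJYle, hs'⟩ := center Y hY hY2 hJY s hs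
  set X' := fun ω => ρ • X ω + b with hX'def
  set Y' := fun ω => ρ • Y ω + c with hY'def
  have hXm : Measurable X' := by fun_prop
  have hYm : Measurable Y' := by fun_prop
  have hXY' : IndepFun X' Y' P :=
    hXY.comp (φ := fun x => ρ • x + b) (ψ := fun x => ρ • x + c) (by fun_prop) (by fun_prop)
  have hPX' : IsProbabilityMeasure (P.map X') := Measure.isProbabilityMeasure_map hXm.aemeasurable
  have hPY' : IsProbabilityMeasure (P.map Y') := Measure.isProbabilityMeasure_map hYm.aemeasurable
  have hA' := hA Ω P X' Y' hXm hYm hXY' (hX2'.integrable one_le_two) hX0'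
    (hY2'.integrable one_le_two) hY0' (1 / 2) (by norm_num) (by norm_num)
  have hhalf : (1 : ℝ) - 1 / 2 = 1 / 2 := by norm_num
  rw [hhalf] at hA'
  have hMX' := (sqMoment_map_lt_top_iff hXm).2 hX2'
  have hMY' := (sqMoment_map_lt_top_iff hYm).2 hY2'
  have hSm : Measurable fun ω => √(1 / 2) • X' ω + √(1 / 2) • Y' ω := by fun_prop
  have hPS' : IsProbabilityMeasure (P.map fun ω => √(1 / 2) • X' ω + √(1 / 2) • Y' ω) :=
    Measure.isProbabilityMeasure_map hSm.aemeasurable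
  have hMS' : sqMoment (P.map fun ω => √(1 / 2) • X' ω + √(1 / 2) • Y' ω) < ∞ :=
    (sqMoment_map_lt_top_iff hSm).2 ((hX2'.const_smul √(1 / 2)).add (hY2'.const_smul √(1 / 2)))
  have hMSeq := toReal_sqMoment_map_add hXm hYm hXY' hX2' hY2' hX0' √(1 / 2) √(1 / 2)
  rw [Real.sq_sqrt (by norm_num)] at hMSeq
  have hlog2 : Real.log √(1 / 2) = -Real.log 2 / 2 := by
    rw [Real.log_sqrt (by norm_num), one_div, Real.log_inv]
  have hσ : 0 < √(1 / 2) * ρ := by positivity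
  have ht' : diffEntropy (P.map fun ω => √(1 / 2) • X' ω + √(1 / 2) • Y' ω)
      = ((t + d * Real.log (√(1 / 2) * ρ) : ℝ) : EReal) := by
    have h := diffEntropy_map_affine ht hσ (√(1 / 2) • (b + c))
    rw [map_affine_comp (X := fun ω => X ω + Y ω) (hX.add hY)] at h
    rw [← h]
    congr 2
    ext1 ω
    simp only [hX'def, hY'def, smul_add, smul_smul]
    abel
  obtain ⟨nX, eX⟩ := relEntropy_eq_ofReal hMX' hr'
  obtain ⟨nY, eY⟩ := relEntropy_eq_ofReal hMY' hs'
  obtain ⟨nS, eS⟩ := relEntropy_eq_ofReal hMS' ht'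
  have hIX := relFisherInfo_lt_top hMX' hJX'
  have hIY := relFisherInfo_lt_top hMY' hJY'
  have hIX0 : 0 ≤ (relFisherInfo (P.map X')).toReal := ENNReal.toReal_nonneg
  have hIY0 : 0 ≤ (relFisherInfo (P.map Y')).toReal := ENNReal.toReal_nonneg
  rw [eX, eY, eS, ← ENNReal.ofReal_toReal hIX.ne, ← ENNReal.ofReal_toReal hIY.ne,
    ← ENNReal.ofReal_mul (by norm_num), ← ENNReal.ofReal_mul (by norm_num),
    ← ENNReal.ofReal_add nX nY, ← ENNReal.ofReal_add (by positivity) (by positivity),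
    ← ENNReal.ofReal_add (by positivity) nS, ENNReal.ofReal_le_ofReal_iff (by positivity),
    toReal_relFisherInfo hMX' hJX', toReal_relFisherInfo hMY' hJY', hMSeq,
    Real.log_mul (by positivity) hρ0.ne', hlog2] at hA'
  have e1 : JX / ρ ^ 2 + JY / ρ ^ 2 = 2 * d := by rw [hρ2]; field_simp
  have e2 : Real.log ((JX + JY) / d) = Real.log 2 + 2 * Real.log ρ := by
    rw [← Real.log_rpow hρ0, ← Real.log_mul two_ne_zero (by positivity)]
    congr 1
    rw [Real.rpow_two, hρ2]; field_simp
  rw [e2]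
  linarith only [hA', e1, hJXle, hJYle]

/-- The sum bound for √θ X and √(1-θ) Y contains log of (J(X)/θ + J(Y)/(1-θ))/d; after absorbing log
θ + log(1-θ) from the dilations, log x ≤ x - 1 turns it into the linear combination (1-θ)J(X) +
θJ(Y) of (A). -/
theorem InterpolationInequality.of_entropySumBound (hK : EntropySumBound.{u} d)
    (hS : StamInequality d) (hd : 0 < d) : InterpolationInequality.{u} d := by
  intro Ω _ P _ X Y hX hY hXY hXi hX0 hYi hY0 θ hθ0 hθ1
  have hd' : (0 : ℝ) < d := by positivity
  have hPX : IsProbabilityMeasure (P.map X) := Measure.isProbabilityMeasure_map hX.aemeasurable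
  have hPY : IsProbabilityMeasure (P.map Y) := Measure.isProbabilityMeasure_map hY.aemeasurable
  -- Stam's inequality linearized by log x ≤ x - 1 at x = J/d. It settles the endpoints θ = 0 and θ
  -- = 1, where the dilation by √θ or √(1-θ) degenerates.
  have lsi : ∀ μ : Measure (EuclideanSpace ℝ (Fin d)), IsProbabilityMeasure μ →
      relEntropy μ ≤ ENNReal.ofReal (1 / 2) * relFisherInfo μ := by
    intro μ _
    by_cases hI : relFisherInfo μ = ∞
    · rw [hI, ENNReal.mul_top (by simp)]; exact le_top
    have hI' := lt_top_iff_ne_top.2 hI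
    have hM := sqMoment_lt_top_of_relFisherInfo hI'
    have hJ := fisherInfo_lt_top hM hI'
    obtain ⟨r, hr, hJ0, hle⟩ := hS μ hM hJ
    obtain ⟨hnn, hD⟩ := relEntropy_eq_ofReal hM hr
    rw [hD, ← ENNReal.ofReal_toReal hI, ← ENNReal.ofReal_mul (by positivity)]
    refine ENNReal.ofReal_le_ofReal ?_
    rw [toReal_relFisherInfo hM hJ]
    have hlog := Real.log_le_sub_one_of_pos (div_pos hJ0 hd')
    have h2 : d / 2 * Real.log ((fisherInfo μ).toReal / d) ≤ (fisherInfo μ).toReal / 2 - d / 2 := by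
      calc d / 2 * Real.log ((fisherInfo μ).toReal / d)
          ≤ d / 2 * ((fisherInfo μ).toReal / d - 1) := by gcongr
        _ = _ := by field_simp
    linarith
  rcases hθ0.eq_or_lt with rfl | hθ0
  · have e : P.map (fun ω => √0 • X ω + √(1 - 0) • Y ω) = P.map Y := by simp
    rw [e]
    refine (add_le_add_left (lsi _ hPX) _).trans ?_
    simp
  rcases hθ1.eq_or_lt with rfl | hθ1
  · have e : P.map (fun ω => √1 • X ω + √(1 - 1) • Y ω) = P.map X := by simp
    rw [e, add_comm (relEntropy (P.map X))]
    refine (add_le_add_left (lsi _ hPY) _).trans ?_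
    simp
  -- Both weights are now positive, so an infinite I makes the right side infinite. Otherwise the
  -- finite I supplies the second moments that (A) does not assume.
  by_cases hIX : relFisherInfo (P.map X) = ∞
  · rw [hIX, ENNReal.mul_top (by simp; linarith)]; simp
  by_cases hIY : relFisherInfo (P.map Y) = ∞
  · rw [hIY, ENNReal.mul_top (by simp; linarith)]; simp
  have hMX := sqMoment_lt_top_of_relFisherInfo (lt_top_iff_ne_top.2 hIX)
  have hMY := sqMoment_lt_top_of_relFisherInfo (lt_top_iff_ne_top.2 hIY)
  have hJX := fisherInfo_lt_top hMX (lt_top_iff_ne_top.2 hIX)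
  have hJY := fisherInfo_lt_top hMY (lt_top_iff_ne_top.2 hIY)
  have hX2 := (sqMoment_map_lt_top_iff hX).1 hMX
  have hY2 := (sqMoment_map_lt_top_iff hY).1 hMY
  obtain ⟨r, hr, hJX0, -⟩ := hS _ hMX hJX
  obtain ⟨s, hs, hJY0, -⟩ := hS _ hMY hJY
  have hθ1' : 0 < 1 - θ := by linarith
  have hSm : Measurable fun ω => √θ • X ω + √(1 - θ) • Y ω := by fun_prop
  have hPS : IsProbabilityMeasure (P.map fun ω => √θ • X ω + √(1 - θ) • Y ω) :=
    Measure.isProbabilityMeasure_map hSm.aemeasurable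
  have hMS : sqMoment (P.map fun ω => √θ • X ω + √(1 - θ) • Y ω) < ∞ :=
    (sqMoment_map_lt_top_iff hSm).2 ((hX2.const_smul √θ).add (hY2.const_smul √(1 - θ)))
  rcases entropy_dichotomy hMS with ⟨-, hD⟩ | ⟨t, ht, nS, eS⟩
  · rw [hD, add_top]; exact le_top
  have hMSeq := toReal_sqMoment_map_add hX hY hXY hX2 hY2 hX0 √θ √(1 - θ)
  rw [Real.sq_sqrt hθ0.le, Real.sq_sqrt hθ1'.le] at hMSeq
  obtain ⟨nX, eX⟩ := relEntropy_eq_ofReal hMX hr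
  obtain ⟨nY, eY⟩ := relEntropy_eq_ofReal hMY hs
  have scale : ∀ (Z : Ω → EuclideanSpace ℝ (Fin d)) (a : ℝ), Measurable Z → 0 < a →
      (P.map Z).map (fun x => √a • x + 0) = P.map fun ω => √a • Z ω := by
    intro Z a hZ _
    rw [map_affine_comp hZ]; simp
  have hsθ : 0 < √θ := by positivity
  have hsθ1 : 0 < √(1 - θ) := by positivity
  have hrX := diffEntropy_map_affine hr hsθ 0
  have hsY := diffEntropy_map_affine hs hsθ1 0
  have hJX1 := fisherInfo_map_affine_lt_top hJX hsθ 0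
  have hJY1 := fisherInfo_map_affine_lt_top hJY hsθ1 0
  have hJX2 := toReal_fisherInfo_map_affine_le hJX hsθ 0
  have hJY2 := toReal_fisherInfo_map_affine_le hJY hsθ1 0
  rw [scale X θ hX hθ0] at hrX hJX1 hJX2
  rw [scale Y (1 - θ) hY hθ1'] at hsY hJY1 hJY2
  have hPX1 : IsProbabilityMeasure (P.map fun ω => √θ • X ω) :=
    Measure.isProbabilityMeasure_map (hX.const_smul √θ).aemeasurable
  obtain ⟨-, -, hJX3, -⟩ := hS _ ((sqMoment_map_lt_top_iff (hX.const_smul √θ)).2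
    (hX2.const_smul √θ)) hJX1
  have h := hK Ω P (fun ω => √θ • X ω) (fun ω => √(1 - θ) • Y ω) (hX.const_smul √θ)
    (hY.const_smul √(1 - θ)) (hXY.comp (φ := fun x => √θ • x) (ψ := fun x => √(1 - θ) • x) (by fun_prop)
      (by fun_prop)) (hX2.const_smul √θ) (hY2.const_smul √(1 - θ)) hJX1 hJY1 _ _ t hrX hsY ht
  rw [Real.sq_sqrt hθ0.le] at hJX2
  rw [Real.sq_sqrt hθ1'.le] at hJY2
  have hIX0 : 0 ≤ (relFisherInfo (P.map X)).toReal := ENNReal.toReal_nonneg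
  have hIY0 : 0 ≤ (relFisherInfo (P.map Y)).toReal := ENNReal.toReal_nonneg
  have hI1 := toReal_relFisherInfo hMX hJX
  have hI2 := toReal_relFisherInfo hMY hJY
  rw [eX, eY, eS, ← ENNReal.ofReal_toReal hIX, ← ENNReal.ofReal_toReal hIY,
    ← ENNReal.ofReal_mul (by linarith), ← ENNReal.ofReal_mul (by linarith),
    ← ENNReal.ofReal_add nX nY, ← ENNReal.ofReal_add (by positivity) (by positivity),
    ← ENNReal.ofReal_add (by positivity) nS]
  refine ENNReal.ofReal_le_ofReal ?_
  rw [hI1, hI2, hMSeq]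
  set JX := (fisherInfo (P.map X)).toReal
  set JY := (fisherInfo (P.map Y)).toReal
  set JX' := (fisherInfo (P.map fun ω => √θ • X ω)).toReal
  set JY' := (fisherInfo (P.map fun ω => √(1 - θ) • Y ω)).toReal
  have hJY3 : 0 ≤ JY' := ENNReal.toReal_nonneg
  rw [Real.log_sqrt hθ0.le, Real.log_sqrt hθ1'.le] at h
  -- log x ≤ x - 1 is used at x = θ(1-θ)(JX' + JY')/d, with JX' ≤ JX/θ and JY' ≤ JY/(1-θ).
  have hlog : Real.log θ + Real.log (1 - θ) + Real.log ((JX' + JY') / d)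
      ≤ ((1 - θ) * JX + θ * JY) / d - 1 := by
    have hT : 0 < (JX' + JY') / d := by positivity
    rw [← Real.log_mul hθ0.ne' hθ1'.ne', ← Real.log_mul (by positivity) hT.ne']
    refine (Real.log_le_sub_one_of_pos (by positivity)).trans ?_
    have h1 : (JX' + JY') / d ≤ (JX / θ + JY / (1 - θ)) / d := by gcongr
    have h2 : θ * (1 - θ) * ((JX / θ + JY / (1 - θ)) / d) = ((1 - θ) * JX + θ * JY) / d := by
      field_simp
    have h3 := mul_le_mul_of_nonneg_left h1 (mul_pos hθ0 hθ1').le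
    linarith
  have hlog2 : d / 2 * (Real.log θ + Real.log (1 - θ) + Real.log ((JX' + JY') / d))
      ≤ ((1 - θ) * JX + θ * JY) / 2 - d / 2 := by
    calc _ ≤ d / 2 * (((1 - θ) * JX + θ * JY) / d - 1) := by gcongr
      _ = _ := by field_simp
  linarith only [h, hlog2]

end Interpolation

/-- In every dimension, the interpolation inequality is equivalent to the reverse entropy power
inequality, and also to the conjunction of the reverse entropy power inequality and the reverse
Fisher information inequality. -/
theorem mainTheorem3 (d : ℕ) (hd : 0 < d) :
    (InterpolationInequality.{u} d ↔ ReverseEPI.{u} d) ∧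
      (InterpolationInequality.{u} d ↔ (ReverseEPI.{u} d ∧ ReverseFII.{u} d)) := by
  have hAK : InterpolationInequality.{u} d → EntropySumBound.{u} d ∧ StamInequality d :=
    fun hA => ⟨hA.entropySumBound (hA.stamInequality hd) hd, hA.stamInequality hd⟩
  have hAB : InterpolationInequality.{u} d → ReverseEPI.{u} d := fun hA =>
    ReverseEPI.of_entropySumBound (hAK hA).1 (hAK hA).2 hd
  have hBA : ReverseEPI.{u} d → InterpolationInequality.{u} d := fun hB =>
    InterpolationInequality.of_entropySumBound
      (hB.entropySumBound (hB.stamInequality hd) hd) (hB.stamInequality hd) hd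
  exact ⟨⟨hAB, hBA⟩, fun hA => ⟨hAB hA, ReverseFII.of_entropySumBound (hAK hA).1 (hAK hA).2 hd⟩,
    fun h => hBA h.1⟩
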